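/- Consider the two-sorted signature with sorts $\tau_e$ (elements) and $\tau_l$ (lists), function symbols $bc:\tau_l\times\tau_e\to\tau_l$, $cons:\tau_e\times\tau_l\to\tau_l$, $h:\tau_e\times\tau_e\to\tau_e$, a constant $nil:\tau_l$, and a countable (possibly empty) set $C$ of further constants, all of sort $\tau_e$; each sort has countably infinitely many variables. Let $\mathcal{BC}_0$ be the equational theory whose only axioms are $$bc(nil,z)=nil,\qquad bc(cons(x,Y),z)=cons\bigl(h(x,z),\,bc(Y,h(x,z))\bigr)$$ (so $h$ is a free, uninterpreted symbol). A unification problem in standard form is a finite set $\mathcal{P}$ of equations, each of one of the forms $$U=V,\quad U=bc(V,y),\quad U=cons(v,W),\quad U=nil,\quad u=v,\quad v=h(w,x),\quad u=c,$$ where $U,V,W$ are list variables, $u,v,w,x,y$ are element variables (in both cases not necessarily distinct) and $c\in C$. It is unifiable modulo $\mathcal{BC}_0$ if there is a sort-preserving substitution $\sigma$ of terms for variables such that $\sigma(s)\approx_{\mathcal{BC}_0}\sigma(t)$ for every equation $s=t$ of $\mathcal{P}$, where $\approx_{\mathcal{BC}_0}$ is the congruence on terms generated by all instances of the axioms. Then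 unifiability modulo $\mathcal{BC}_0$ of problems $\mathcal{P}$ in standard form is decidable in polynomial time with respect to the size of $\mathcal{P}$: there are a (multi-stack) Turing machine and a polynomial $p$ such that the machine, given any problem $\mathcal{P}$ in standard form written as a word of length $n$ over a fixed finite alphabet, with names of variables and constants in binary, halts within $p(n)$ steps and outputs whether $\mathcal{P}$ is unifiable modulo $\mathcal{BC}_0$. -/

import Mathlib

namespace BC

/-- The two disjoint sorts: elements and lists. -/
inductive Srt where
  | elem
  | list

/-- Well-typed terms of each sort over the two-sorted signature `bc`, `cons`, `h`, `nil`, together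
with the set `C` of constants, all of sort `elem`. Each sort has its own countably infinite supply
of variables, indexed by `ℕ`. -/
inductive Term (C : Type) : Srt → Type where
  | var {s : Srt} (n : ℕ) : Term C s
  | const (c : C) : Term C .elem
  | h (x y : Term C .elem) : Term C .elem
  | nil : Term C .list
  | cons (x : Term C .elem) (Y : Term C .list) : Term C .list
  | bc (X : Term C .list) (y : Term C .elem) : Term C .list

/-- Sort-preserving substitutions. -/
def Subst (C : Type) : Type := ∀ s : Srt, ℕ → Term C s

/-- Application of a substitution to a term. -/
def Term.subst {C : Type} (σ : Subst C) : ∀ {s : Srt}, Term C s → Term C s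
  | s, .var n => σ s n
  | _, .const c => .const c
  | _, .h x y => .h (x.subst σ) (y.subst σ)
  | _, .nil => .nil
  | _, .cons x Y => .cons (x.subst σ) (Y.subst σ)
  | _, .bc X y => .bc (X.subst σ) (y.subst σ)

/-- Equality modulo the theory in which `h` is a free symbol: the least congruence on the terms of
both sorts that contains all instances of the two axioms
`bc(nil, z) = nil` and `bc(cons(x, Y), z) = cons(h(x, z), bc(Y, h(x, z)))`. -/
inductive EqBC0 {C : Type} : ∀ {s : Srt}, Term C s → Term C s → Prop where
  | bc_nil (z : Term C .elem) : EqBC0 (.bc .nil z) .nil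
  | bc_cons (x z : Term C .elem) (Y : Term C .list) :
      EqBC0 (.bc (.cons x Y) z) (.cons (.h x z) (.bc Y (.h x z)))
  | refl {s : Srt} (t : Term C s) : EqBC0 t t
  | symm {s : Srt} {t u : Term C s} : EqBC0 t u → EqBC0 u t
  | trans {s : Srt} {t u v : Term C s} : EqBC0 t u → EqBC0 u v → EqBC0 t v
  | h_congr {x x' y y' : Term C .elem} : EqBC0 x x' → EqBC0 y y' → EqBC0 (.h x y) (.h x' y')
  | cons_congr {x x' : Term C .elem} {Y Y' : Term C .list} :
      EqBC0 x x' → EqBC0 Y Y' → EqBC0 (.cons x Y) (.cons x' Y')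
  | bc_congr {X X' : Term C .list} {y y' : Term C .elem} :
      EqBC0 X X' → EqBC0 y y' → EqBC0 (.bc X y) (.bc X' y')

/-- The seven forms of equations allowed in a problem in standard form. The arguments are indices
of variables of the appropriate sort (and a constant in the last case). -/
inductive StdEq (C : Type) where
  /-- `U = V`, between list variables -/
  | listVar (U V : ℕ)
  /-- `U = bc(V, y)` -/
  | bc (U V y : ℕ)
  /-- `U = cons(v, W)` -/
  | cons (U v W : ℕ)
  /-- `U = nil` -/
  | nil (U : ℕ)
  /-- `u = v`, between element variables -/
  | elemVar (u v : ℕ)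
  /-- `v = h(w, x)` -/
  | h (v w x : ℕ)
  /-- `u = c`, with `c` a constant of sort `elem` -/
  | const (u : ℕ) (c : C)

namespace StdEq

variable {C : Type}

/-- The common sort of the two sides of an equation. -/
def srt : StdEq C → Srt
  | .listVar _ _ | .bc _ _ _ | .cons _ _ _ | .nil _ => .list
  | .elemVar _ _ | .h _ _ _ | .const _ _ => .elem

/-- The left-hand side, always a variable. -/
def lhs : (e : StdEq C) → Term C e.srt
  | .listVar U _ | .bc U _ _ | .cons U _ _ | .nil U => (.var U : Term C .list)
  | .elemVar u _ | .h u _ _ | .const u _ => (.var u : Term C .elem)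

/-- The right-hand side. -/
def rhs : (e : StdEq C) → Term C e.srt
  | .listVar _ V => (.var V : Term C .list)
  | .bc _ V y => .bc (.var V) (.var y)
  | .cons _ v W => .cons (.var v) (.var W)
  | .nil _ => .nil
  | .elemVar _ v => (.var v : Term C .elem)
  | .h _ w x => .h (.var w) (.var x)
  | .const _ c => .const c

end StdEq

/-- A unification problem in standard form: a finite collection of standard equations, presented
as a list. -/
abbrev Problem (C : Type) : Type := List (StdEq C)

/-- A problem is unifiable if some substitution makes the two sides of each of its equations equal
modulo the theory. -/
def Unifiable {C : Type} (P : Problem C) : Prop :=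
  ∃ σ : Subst C, ∀ e ∈ P, EqBC0 (e.lhs.subst σ) (e.rhs.subst σ)

/-- The finite alphabet in which problems are written down: one tag for each of the seven forms of
equations, the two binary digits, and an end marker for names. -/
inductive Letter where
  | tag (k : Fin 7)
  | bit (b : Bool)
  | mark

/-- A name (index of a variable or code of a constant), written in binary. -/
def writeName (n : ℕ) : List Letter :=
  (Computability.encodeNat n).map Letter.bit ++ [Letter.mark]

/-- An equation is written as its tag followed by the names that occur in it. -/
def writeEq {C : Type} [Encodable C] : StdEq C → List Letter
  | .listVar U V => .tag 0 :: (writeName U ++ writeName V)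
  | .bc U V y => .tag 1 :: (writeName U ++ writeName V ++ writeName y)
  | .cons U v W => .tag 2 :: (writeName U ++ writeName v ++ writeName W)
  | .nil U => .tag 3 :: writeName U
  | .elemVar u v => .tag 4 :: (writeName u ++ writeName v)
  | .h v w x => .tag 5 :: (writeName v ++ writeName w ++ writeName x)
  | .const u c => .tag 6 :: (writeName u ++ writeName (Encodable.encode c))

/-- A problem is written as the concatenation of its equations; the length of this word is the
size of the problem. -/
def writeProblem {C : Type} [Encodable C] (P : Problem C) : List Letter :=
  P.flatMap writeEq

theorem writeName_append {m n : ℕ} {l r : List Letter} (h : writeName m ++ l = writeName n ++ r) :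
    m = n ∧ l = r := by
  have key : ∀ a b : List Bool, a.map Letter.bit ++ Letter.mark :: l = b.map Letter.bit ++ Letter.mark :: r →
      a = b ∧ l = r := by
    intro a
    induction a with
    | nil => intro b hb; cases b <;> simp_all
    | cons x a ih => intro b hb; cases b with
      | nil => simp at hb
      | cons y b => simp at hb; have := ih b hb.2; simp_all
  simp only [writeName, List.append_assoc, List.singleton_append] at h
  obtain ⟨h1, h2⟩ := key _ _ h
  refine ⟨?_, h2⟩
  have := congrArg Computability.decodeNat h1
  simpa using this

theorem writeEq_append {C : Type} [Encodable C] {e f : StdEq C} {l r : List Letter}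
    (h : writeEq e ++ l = writeEq f ++ r) : e = f ∧ l = r := by
  cases e <;> cases f <;> simp [writeEq, List.append_assoc] at h ⊢ <;>
    (obtain ⟨h1, h⟩ := writeName_append h
     try (replace h := writeName_append h; obtain ⟨h2, h⟩ := h)
     try (replace h := writeName_append h; obtain ⟨h3, h⟩ := h)
     simp_all)

/-- The written form of a problem determines the problem. -/
theorem writeProblem_injective {C : Type} [Encodable C] :
    Function.Injective (writeProblem (C := C)) := by
  intro P
  induction P with
  | nil => intro Q h; cases Q with
    | nil => rfl
    | cons f Q => cases f <;> simp [writeProblem, writeEq] at h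
  | cons e P ih => intro Q h; cases Q with
    | nil => cases e <;> simp [writeProblem, writeEq] at h
    | cons f Q =>
      simp only [writeProblem, List.flatMap_cons] at h
      obtain ⟨h1, h2⟩ := writeEq_append h
      rw [h1, ih h2]

end BC

/-!
Why unifiability is decidable in polynomial time.

The axioms, read from left to right, evaluate `bc` on lists that are written with `cons` and `nil`.
Hence a problem is unifiable if and only if it is solvable with element terms as values of the
element variables and finite lists of element terms as values of the list variables, where
`bc([x₁, …, xₘ], z)` is the chain `[y₁, …, yₘ]` with `y₁ = h(x₁, z)` and `yᵢ₊₁ = h(xᵢ₊₁, yᵢ)`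
(`BC.unifiable_iff`). The theory does not identify different element terms, so that element
equations are solved by ordinary unification.

The length of a list variable must be at least what the equations `U = cons(v, W)` force, and there
is no reason to make it longer. A forced entry of a list in a solution has a number that is bounded
by the number of these equations, since their tails `W` have pairwise different lengths
(`BC.Forced.lt`). So only polynomially many nodes have to be considered: the element variables and
the forced entries. The equations say of some nodes that they are equal, of others that they are a
term `h` with two given nodes as arguments, or a constant. This is unification of terms that are
represented as a graph: close equality under passing to the arguments of `h`, and check that there
is no clash, no cycle in the subterm relation, and no entry that must not exist.

All this is a fixed finite set of Horn rules over the positions of the written problem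
(`BC.rule`). Nodes are pairs of positions, and the rules compare the binary names of variables
and constants as well. If the problem has a solution, all derivable facts are true of it, and hence
the fact `fail` is not derivable (`BC.meaning_of_derivable`). If `fail` is not derivable, a solution
can be read off from the derivable facts (`BC.exists_solution`), by recursion along the subterm
relation (`BC.exists_term_assignment`).

It remains that derivability by fixed Horn rules is decidable in polynomial time by a machine with
several stacks (`StackMachine.polyTime_of_rules`). The facts are kept on one stack, with positions
written in unary. A fact is looked up by scanning this stack, and all values of the variables of a
rule are tried in nested loops. Each round of rule applications before the last one yields a new
fact, so the number of rounds that are needed is bounded by a polynomial. The evaluation is a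
program with loops over the positions (`StackMachine.Cmd`), which is compiled to a structured
program over stacks (`StackMachine.Prog`) and then to a Turing machine
(`StackMachine.Prog.polyTime_of_runsIn`).
-/

namespace StackMachine

open Turing

/-! ### Structured programs for Turing machines -/

/-- Structured programs over a family of stacks with alphabets `Γ k` and an internal state in `σ`.
`loop k p` repeats `p` as long as the stack `k` is nonempty. -/
inductive Prog {K : Type} (Γ : K → Type) (σ : Type) : Type
  | load (f : σ → σ) : Prog Γ σ
  | push (k : K) (f : σ → Γ k) : Prog Γ σ
  | pop (k : K) (f : σ → Option (Γ k) → σ) : Prog Γ σ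
  | seq (p q : Prog Γ σ) : Prog Γ σ
  | ite (b : σ → Bool) (p q : Prog Γ σ) : Prog Γ σ
  | loop (k : K) (p : Prog Γ σ) : Prog Γ σ

variable {K : Type} {Γ : K → Type} {σ : Type}

namespace Prog

/-- The control points of a program. -/
def Label : Prog Γ σ → Type
  | load _ | push _ _ | pop _ _ => Unit
  | seq p q => Label p ⊕ Label q
  | ite _ p q => Option (Label p ⊕ Label q)
  | loop _ p => Option (Label p)

theorem finite_label : ∀ p : Prog Γ σ, Finite p.Label
  | load _ | push _ _ | pop _ _ => inferInstanceAs (Finite Unit)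
  | seq p q =>
    have := finite_label p
    have := finite_label q
    inferInstanceAs (Finite (p.Label ⊕ q.Label))
  | ite _ p q =>
    have := finite_label p
    have := finite_label q
    inferInstanceAs (Finite (Option (p.Label ⊕ q.Label)))
  | loop _ p =>
    have := finite_label p
    inferInstanceAs (Finite (Option p.Label))

/-- The control point at which a program starts. -/
def entry : (p : Prog Γ σ) → p.Label
  | load _ | push _ _ | pop _ _ => ()
  | seq p _ => Sum.inl p.entry
  | ite _ _ _ | loop _ _ => none

/-- The machine code of a program whose control points are embedded into the labels `Λ` by `emb`,
and which jumps to `exit` when it is done. The machine remembers one more bit, the outcome of the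
last test of a stack for emptiness. -/
def code {Λ : Type} : (p : Prog Γ σ) → (p.Label → Λ) → Λ → p.Label → TM2.Stmt Γ Λ (σ × Bool)
  | load f, _, exit, _ => .load (fun s => (f s.1, s.2)) (.goto fun _ => exit)
  | push k f, _, exit, _ => .push k (fun s => f s.1) (.goto fun _ => exit)
  | pop k f, _, exit, _ => .pop k (fun s o => (f s.1 o, s.2)) (.goto fun _ => exit)
  | seq p q, emb, _, Sum.inl l => p.code (emb ∘ Sum.inl) (emb (Sum.inr q.entry)) l
  | seq _ q, emb, exit, Sum.inr l => q.code (emb ∘ Sum.inr) exit l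
  | ite b p q, emb, _, none => .branch (fun s => b s.1)
      (.goto fun _ => emb (some (Sum.inl p.entry))) (.goto fun _ => emb (some (Sum.inr q.entry)))
  | ite _ p _, emb, exit, some (Sum.inl l) => p.code (emb ∘ some ∘ Sum.inl) exit l
  | ite _ _ q, emb, exit, some (Sum.inr l) => q.code (emb ∘ some ∘ Sum.inr) exit l
  | loop k p, emb, exit, none => .peek k (fun s o => (s.1, o.isSome)) (.branch (fun s => s.2)
      (.goto fun _ => emb (some p.entry)) (.goto fun _ => exit))
  | loop _ p, emb, _, some l => p.code (emb ∘ some) (emb none) l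

variable [DecidableEq K]

/-- `Runs p s S s' S' t`: started in the state `s` with stacks `S`, the program `p` ends in the
state `s'` with stacks `S'` after exactly `t` steps. -/
inductive Runs : Prog Γ σ → σ → (∀ k, List (Γ k)) → σ → (∀ k, List (Γ k)) → ℕ → Prop
  | load (f s S) : Runs (load f) s S (f s) S 1
  | push (k f s S) : Runs (push k f) s S s (Function.update S k (f s :: S k)) 1
  | pop (k f s S) : Runs (pop k f) s S (f s (S k).head?) (Function.update S k (S k).tail) 1
  | seq {p q s S s' S' s'' S'' t t'} (hp : Runs p s S s' S' t) (hq : Runs q s' S' s'' S'' t') :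
      Runs (seq p q) s S s'' S'' (t + t')
  | ite_true {b p q s S s' S' t} (hb : b s = true) (hp : Runs p s S s' S' t) :
      Runs (ite b p q) s S s' S' (1 + t)
  | ite_false {b p q s S s' S' t} (hb : b s = false) (hq : Runs q s S s' S' t) :
      Runs (ite b p q) s S s' S' (1 + t)
  | loop_nil {k p s S} (hk : S k = []) : Runs (loop k p) s S s S 1
  | loop_cons {k p s S s' S' s'' S'' t t'} (hk : S k ≠ []) (hp : Runs p s S s' S' t)
      (hl : Runs (loop k p) s' S' s'' S'' t') : Runs (loop k p) s S s'' S'' (1 + (t + t'))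

/-- A program that ends within `T` steps. -/
def RunsIn (p : Prog Γ σ) (s : σ) (S : ∀ k, List (Γ k)) (s' : σ) (S' : ∀ k, List (Γ k))
    (T : ℕ) : Prop :=
  ∃ t ≤ T, Runs p s S s' S' t

/-- The machine `M` goes from one configuration to another in `t` steps. -/
def StepsIn {Λ : Type} (M : Λ → TM2.Stmt Γ Λ σ) (c c' : TM2.Cfg Γ Λ σ) (t : ℕ) : Prop :=
  (flip bind (TM2.step M))^[t] (some c) = some c'

theorem StepsIn.trans {Λ : Type} {M : Λ → TM2.Stmt Γ Λ σ} {c c' c'' : TM2.Cfg Γ Λ σ} {t t' : ℕ}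
    (h : StepsIn M c c' t) (h' : StepsIn M c' c'' t') : StepsIn M c c'' (t + t') := by
  unfold StepsIn at *
  rw [add_comm, Function.iterate_add_apply, h, h']

theorem StepsIn.one {Λ : Type} {M : Λ → TM2.Stmt Γ Λ σ} {c c' : TM2.Cfg Γ Λ σ}
    (h : TM2.step M c = some c') : StepsIn M c c' 1 := h

/-- The machine code of a program simulates the program step by step. -/
theorem Runs.stepsIn {Λ : Type} {M : Λ → TM2.Stmt Γ Λ (σ × Bool)} {p : Prog Γ σ} {s S s' S' t}
    (h : Runs p s S s' S' t) : ∀ (emb : p.Label → Λ) (exit : Λ),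
      (∀ l, M (emb l) = p.code emb exit l) → ∀ b, ∃ b',
      StepsIn M ⟨some (emb p.entry), (s, b), S⟩ ⟨some exit, (s', b'), S'⟩ t := by
  induction h with
  | load f s S =>
    intro emb exit hM b
    exact ⟨b, .one (by simp [hM, code])⟩
  | push k f s S =>
    intro emb exit hM b
    exact ⟨b, .one (by simp [hM, code])⟩
  | pop k f s S =>
    intro emb exit hM b
    exact ⟨b, .one (by simp [hM, code])⟩
  | seq hp hq ihp ihq =>
    intro emb exit hM b
    obtain ⟨b', h1⟩ := ihp (emb ∘ Sum.inl) _ (fun l => hM (Sum.inl l)) b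
    obtain ⟨b'', h2⟩ := ihq (emb ∘ Sum.inr) exit (fun l => hM (Sum.inr l)) b'
    exact ⟨b'', h1.trans h2⟩
  | ite_true hb hp ih =>
    intro emb exit hM b
    have hn := hM none
    obtain ⟨b', h1⟩ := ih (emb ∘ some ∘ Sum.inl) exit (fun l => hM (some (Sum.inl l))) b
    exact ⟨b', StepsIn.trans (.one (by simp [entry, hn, code, hb]; rfl)) h1⟩
  | ite_false hb hp ih =>
    intro emb exit hM b
    have hn := hM none
    obtain ⟨b', h1⟩ := ih (emb ∘ some ∘ Sum.inr) exit (fun l => hM (some (Sum.inr l))) b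
    exact ⟨b', StepsIn.trans (.one (by simp [entry, hn, code, hb]; rfl)) h1⟩
  | loop_nil hk =>
    intro emb exit hM b
    have hn := hM none
    exact ⟨false, .one (by simp [entry, hn, code, hk])⟩
  | loop_cons hk hp hl ihp ihl =>
    intro emb exit hM b
    obtain ⟨b', h1⟩ := ihp (emb ∘ some) (emb none) (fun l => hM (some l)) true
    obtain ⟨b'', h2⟩ := ihl emb exit hM b'
    refine ⟨b'', StepsIn.trans (.one ?_) (h1.trans h2)⟩
    have hn := hM none
    obtain ⟨x, l, hl⟩ := List.exists_cons_of_ne_nil hk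
    simp [entry, hn, code, hl]
    rfl

/-- The Turing machine that executes a program and then resets its internal state. -/
noncomputable def toFinTM2 [Fintype K] [Fintype σ] (p : Prog Γ σ) (s₀ : σ) (k₀ k₁ : K)
    [Fintype (Γ k₀)] : FinTM2 where
  K := K
  k₀ := k₀
  k₁ := k₁
  Γ := Γ
  Λ := Option p.Label
  main := some p.entry
  ΛFin :=
    have := p.finite_label
    Fintype.ofFinite (Option p.Label)
  σ := σ × Bool
  initialState := (s₀, false)
  m
    | none => .load (fun _ => (s₀, false)) .halt
    | some l => p.code some none l

/-- A function is computable in polynomial time if some program takes the stacks holding just the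
input to the stacks holding just the output, within polynomially many steps. -/
theorem polyTime_of_runsIn [Fintype K] [Fintype σ] (p : Prog Γ σ) (s₀ : σ) (k₀ k₁ : K)
    [Fintype (Γ k₀)] {α β : Type} (ea : α → List (Γ k₀)) (eb : β → List (Γ k₁)) (f : α → β)
    (time : Polynomial ℕ)
    (h : ∀ a, ∃ s', RunsIn p s₀ (Function.update (fun _ => []) k₀ (ea a)) s'
      (Function.update (fun _ => []) k₁ (eb (f a))) (time.eval (ea a).length)) :
    Nonempty (TM2ComputableInPolyTime ea eb f) := by
  classical
  choose s' t ht hr using h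
  refine ⟨{
    tm := p.toFinTM2 s₀ k₀ k₁
    inputAlphabet := Equiv.refl _
    outputAlphabet := Equiv.refl _
    time := time + 1
    outputsFun := fun a => ⟨⟨t a + 1, ?_⟩, ?_⟩ }⟩
  · have h1 := (hr a).stepsIn (M := (p.toFinTM2 s₀ k₀ k₁).m) some none (fun l => rfl) false
    obtain ⟨b, h1⟩ := h1
    have h2 := h1.trans (StepsIn.one (c' := ⟨none, (s₀, false), _⟩) (by simp [toFinTM2]; rfl))
    have e : ∀ (k : K) (l : List (Γ k)), (fun j => @dite (List (Γ j)) (j = k) (by infer_instance)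
        (fun h => by rw [h]; exact l) (fun _ => [])) = Function.update (fun _ => []) k l := by
      intro k l
      funext j
      by_cases hj : j = k
      · subst hj; simp
      · simp [hj]
    have e0 : initList (p.toFinTM2 s₀ k₀ k₁) (List.map (Equiv.refl _).invFun (ea a)) =
        (⟨some (some p.entry), (s₀, false), Function.update (fun _ => []) k₀ (ea a)⟩ :
          TM2.Cfg Γ (Option p.Label) (σ × Bool)) := by
      unfold initList
      congr 1
      rw [← e]
      simp
      rfl
    have e1 : haltList (p.toFinTM2 s₀ k₀ k₁) (List.map (Equiv.refl _).invFun (eb (f a))) =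
        (⟨none, (s₀, false), Function.update (fun _ => []) k₁ (eb (f a))⟩ :
          TM2.Cfg Γ (Option p.Label) (σ × Bool)) := by
      unfold haltList
      congr 1
      rw [← e]
      simp
      rfl
    simp only [Option.map_some]
    exact (congrArg _ (congrArg some e0)).trans (Eq.trans h2 (congrArg some e1.symm))
  · simpa using ht a

end Prog

end StackMachine

namespace StackMachine

open Function

/-! ### Facts on stacks -/

/-- The tapes that hold words: `facts` holds the database, `query` the fact that is looked up, and
the primed ones are their other halves, onto which they are moved while they are read. -/
inductive Tape
  | facts | facts' | query | query'
  deriving DecidableEq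

instance : Fintype Tape := ⟨{.facts, .facts', .query, .query'}, fun w => by cases w <;> simp⟩

/-- The unary counters: a register `i` with value `x` in a universe `{0, …, n}` is represented by
the two counters `up i`, with value `x`, and `down i`, with value `n - x`; `temp` is used to copy
registers. -/
inductive Counter (I : Type)
  | up (i : I) | down (i : I) | temp
  deriving DecidableEq, Fintype

/-- The stacks of the machine that evaluates database programs. -/
inductive Stack (I : Type)
  | input | output | counter (c : Counter I) | tape (w : Tape)
  deriving DecidableEq, Fintype

/-- The symbols of the written form of a fact: a relation symbol, which ends the fact, a stroke
`Sum.inr true`, or the separator `Sum.inr false`, which ends an argument. -/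
abbrev Symb (R : Type) : Type := R ⊕ Bool

/-- The alphabets of the stacks. -/
abbrev alphabet (A R I : Type) : Stack I → Type
  | .input => A
  | .output => Bool
  | .counter _ => Unit
  | .tape _ => Symb R

/-- The internal state: the input letter read last, the symbols read last from the database and
from the query, whether the present fact agrees with the query so far, and whether the query has
been found. -/
structure Ctl (A R : Type) where
  letter : Option A
  symb : Option (Symb R)
  symb' : Option (Symb R)
  ok : Bool
  found : Bool
  deriving Fintype

/-- The contents of the stacks. -/
structure Store (A R I : Type) where
  input : List A
  output : List Bool
  counter : Counter I → ℕ
  tape : Tape → List (Symb R)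

variable {A R I : Type}

/-- The contents of the stacks, as a family of lists. -/
def Store.toStacks (m : Store A R I) : ∀ k, List (alphabet A R I k)
  | .input => m.input
  | .output => m.output
  | .counter c => List.replicate (m.counter c) ()
  | .tape w => m.tape w

variable [DecidableEq I]

theorem Store.update_input (m : Store A R I) (l : List A) :
    update m.toStacks .input l = Store.toStacks { m with input := l } := by
  funext k
  cases k <;> simp [update, toStacks]

theorem Store.update_output (m : Store A R I) (l : List Bool) :
    update m.toStacks .output l = Store.toStacks { m with output := l } := by
  funext k
  cases k <;> simp [update, toStacks]

theorem Store.update_counter (m : Store A R I) (c : Counter I) (x : ℕ) :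
    update m.toStacks (.counter c) (List.replicate x ()) =
      Store.toStacks { m with counter := update m.counter c x } := by
  funext k
  rcases k with _ | _ | d | _
  · simp [toStacks]
  · simp [toStacks]
  · by_cases h : d = c
    · subst h; simp [toStacks]
    · simp [toStacks, h]
  · simp [toStacks]

theorem Store.update_tape (m : Store A R I) (w : Tape) (l : List (Symb R)) :
    update m.toStacks (.tape w) l = Store.toStacks { m with tape := update m.tape w l } := by
  funext k
  rcases k with _ | _ | _ | d
  · simp [toStacks]
  · simp [toStacks]
  · simp [toStacks]
  · by_cases h : d = w
    · subst h; simp [toStacks]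
    · simp [toStacks, h]

/-- Programs of the machine that evaluates database programs. -/
abbrev Code (A R I : Type) : Type := Prog (alphabet A R I) (Ctl A R)

/-- The program takes the state `s` and the store `m` to `s'` and `m'` within `t` steps. -/
def Exec (p : Code A R I) (s : Ctl A R) (m : Store A R I) (s' : Ctl A R) (m' : Store A R I)
    (t : ℕ) : Prop :=
  p.RunsIn s m.toStacks s' m'.toStacks t

namespace Exec

variable {p q : Code A R I} {s s' s'' : Ctl A R} {m m' m'' : Store A R I} {t t' : ℕ}

theorem mono (h : Exec p s m s' m' t) (ht : t ≤ t') : Exec p s m s' m' t' :=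
  let ⟨u, hu, hr⟩ := h
  ⟨u, hu.trans ht, hr⟩

theorem load (f : Ctl A R → Ctl A R) (s : Ctl A R) (m : Store A R I) :
    Exec (.load f) s m (f s) m 1 :=
  ⟨1, le_rfl, .load f s _⟩

theorem seq (h : Exec p s m s' m' t) (h' : Exec q s' m' s'' m'' t') :
    Exec (.seq p q) s m s'' m'' (t + t') :=
  let ⟨_, hu, hr⟩ := h
  let ⟨_, hu', hr'⟩ := h'
  ⟨_, add_le_add hu hu', .seq hr hr'⟩

theorem ite_true {b : Ctl A R → Bool} (hb : b s = true) (h : Exec p s m s' m' t) :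
    Exec (.ite b p q) s m s' m' (1 + t) :=
  let ⟨_, hu, hr⟩ := h
  ⟨_, Nat.add_le_add_left hu 1, .ite_true hb hr⟩

theorem ite_false {b : Ctl A R → Bool} (hb : b s = false) (h : Exec q s m s' m' t) :
    Exec (.ite b p q) s m s' m' (1 + t) :=
  let ⟨_, hu, hr⟩ := h
  ⟨_, Nat.add_le_add_left hu 1, .ite_false hb hr⟩

theorem loop_nil {k : Stack I} (hk : m.toStacks k = []) : Exec (.loop k p) s m s m 1 :=
  ⟨1, le_rfl, .loop_nil hk⟩

theorem loop_cons {k : Stack I} (hk : m.toStacks k ≠ []) (h : Exec p s m s' m' t)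
    (h' : Exec (.loop k p) s' m' s'' m'' t') : Exec (.loop k p) s m s'' m'' (1 + (t + t')) :=
  let ⟨_, hu, hr⟩ := h
  let ⟨_, hu', hr'⟩ := h'
  ⟨_, Nat.add_le_add_left (add_le_add hu hu') 1, .loop_cons hk hr hr'⟩

/-- Adjust the final configuration and the time bound. -/
theorem adjust (h : Exec p s m s' m' t) (hs : s' = s'') (hm : m' = m'') (ht : t ≤ t') :
    Exec p s m s'' m'' t' :=
  hs ▸ hm ▸ h.mono ht

theorem popInput (f : Ctl A R → Option A → Ctl A R) (s : Ctl A R) (m : Store A R I) :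
    Exec (.pop .input f) s m (f s m.input.head?) { m with input := m.input.tail } 1 := by
  have h := Prog.Runs.pop (Γ := alphabet A R I) .input f s m.toStacks
  rw [Store.update_input] at h
  exact ⟨1, le_rfl, h⟩

theorem pushOutput (f : Ctl A R → Bool) (s : Ctl A R) (m : Store A R I) :
    Exec (.push .output f) s m s { m with output := f s :: m.output } 1 := by
  have h := Prog.Runs.push (Γ := alphabet A R I) .output f s m.toStacks
  rw [Store.update_output] at h
  exact ⟨1, le_rfl, h⟩

theorem popTape (w : Tape) (f : Ctl A R → Option (Symb R) → Ctl A R) (s : Ctl A R)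
    (m : Store A R I) : Exec (.pop (.tape w) f) s m (f s (m.tape w).head?)
      { m with tape := update m.tape w (m.tape w).tail } 1 := by
  have h := Prog.Runs.pop (Γ := alphabet A R I) (.tape w) f s m.toStacks
  rw [Store.update_tape] at h
  exact ⟨1, le_rfl, h⟩

theorem pushTape (w : Tape) (f : Ctl A R → Symb R) (s : Ctl A R) (m : Store A R I) :
    Exec (.push (.tape w) f) s m s { m with tape := update m.tape w (f s :: m.tape w) } 1 := by
  have h := Prog.Runs.push (Γ := alphabet A R I) (.tape w) f s m.toStacks
  rw [Store.update_tape] at h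
  exact ⟨1, le_rfl, h⟩

theorem popCounter (c : Counter I) (s : Ctl A R) (m : Store A R I) :
    Exec (.pop (.counter c) fun s _ => s) s m s
      { m with counter := update m.counter c (m.counter c - 1) } 1 := by
  have h := Prog.Runs.pop (Γ := alphabet A R I) (.counter c) (fun s _ => s) s m.toStacks
  have e : (m.toStacks (.counter c)).tail = List.replicate (m.counter c - 1) () :=
    List.tail_replicate
  rw [e, Store.update_counter] at h
  exact ⟨1, le_rfl, h⟩

theorem pushCounter (c : Counter I) (s : Ctl A R) (m : Store A R I) :
    Exec (.push (.counter c) fun _ => ()) s m s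
      { m with counter := update m.counter c (m.counter c + 1) } 1 := by
  have h := Prog.Runs.push (Γ := alphabet A R I) (.counter c) (fun _ => ()) s m.toStacks
  have e : () :: m.toStacks (.counter c) = List.replicate (m.counter c + 1) () := rfl
  rw [e, Store.update_counter] at h
  exact ⟨1, le_rfl, h⟩

end Exec

/-- The empty program. -/
def nop : Code A R I := .load id

theorem exec_nop (s : Ctl A R) (m : Store A R I) : Exec nop s m s m 1 := .load id s m

/-- Move the contents of one counter to another. -/
def transfer (c d : Counter I) : Code A R I :=
  .loop (.counter c) (.seq (.pop (.counter c) fun s _ => s) (.push (.counter d) fun _ => ()))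

theorem exec_transfer {c d : Counter I} (hcd : c ≠ d) (s : Ctl A R) (m : Store A R I) :
    Exec (transfer c d) s m s
      { m with
        counter := update (update m.counter c 0) d (m.counter c + m.counter d) }
      (3 * m.counter c + 1) := by
  generalize hx : m.counter c = x
  induction x generalizing m with
  | zero =>
    refine (Exec.loop_nil (by simp [Store.toStacks, hx])).adjust rfl ?_ le_add_self
    rw [(update_eq_self_iff (a := c)).2 hx.symm]; simp
  | succ x ih =>
    refine (Exec.loop_cons (by simp [Store.toStacks, hx])
      ((Exec.popCounter c s m).seq (Exec.pushCounter d s _)) (ih _ ?_)).adjust rfl ?_ (by lia)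
    · simp [hcd, hx]
    · congr 1
      funext e
      simp only [Function.update_apply]
      split_ifs <;> simp_all
      lia

/-- Empty a counter. -/
def clearCounter (c : Counter I) : Code A R I :=
  .loop (.counter c) (.pop (.counter c) fun s _ => s)

theorem exec_clearCounter (c : Counter I) (s : Ctl A R) (m : Store A R I) :
    Exec (clearCounter c) s m s { m with counter := update m.counter c 0 }
      (2 * m.counter c + 1) := by
  generalize hx : m.counter c = x
  induction x generalizing m with
  | zero =>
    refine (Exec.loop_nil (by simp [Store.toStacks, hx])).adjust rfl ?_ le_add_self
    rw [← hx]; simp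
  | succ x ih =>
    exact (Exec.loop_cons (by simp [Store.toStacks, hx]) (Exec.popCounter c s m)
      (ih _ (by simp [hx]))).adjust rfl (by simp) (by lia)

/-- Move the contents of one tape to another, which reverses it. -/
def move (v w : Tape) : Code A R I :=
  .seq (.loop (.tape v) (.seq (.pop (.tape v) fun s o => { s with symb := o })
    (.push (.tape w) fun s => s.symb.getD (.inr true)))) (.load fun s => { s with symb := none })

theorem exec_move {v w : Tape} (hvw : v ≠ w) (s : Ctl A R) (m : Store A R I) :
    Exec (move v w) s m { s with symb := none }
      { m with
        tape := update (update m.tape v []) w ((m.tape v).reverse ++ m.tape w) }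
      (3 * (m.tape v).length + 2) := by
  suffices H : ∃ s', { s' with symb := none } = { s with symb := none } ∧
      Exec (.loop (.tape v) (.seq (.pop (.tape v) fun s o => { s with symb := o })
        (.push (.tape w) fun s => s.symb.getD (.inr true)))) s m s'
        { m with
          tape := update (update m.tape v []) w ((m.tape v).reverse ++ m.tape w) }
        (3 * (m.tape v).length + 1) by
    obtain ⟨s', hs, h⟩ := H
    rw [← hs]
    exact h.seq (.load _ s' _)
  generalize hx : m.tape v = l
  induction l generalizing m s with
  | nil =>
    refine ⟨s, rfl, (Exec.loop_nil (by simp [Store.toStacks, hx])).adjust rfl ?_ le_add_self⟩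
    rw [(update_eq_self_iff (a := v)).2 hx.symm]; simp
  | cons a l ih =>
    have h1 := (Exec.popTape v (fun s o => { s with symb := o }) s m).seq
      (Exec.pushTape w (fun s => s.symb.getD (.inr true)) _ _)
    obtain ⟨s', hs, h⟩ := ih { s with symb := (m.tape v).head? } { m with
      tape := update (update m.tape v (m.tape v).tail) w ((m.tape v).head?.getD (.inr true) ::
        update m.tape v (m.tape v).tail w) } (by simp [hvw, hx])
    refine ⟨s', by simpa using hs, (Exec.loop_cons (by simp [Store.toStacks, hx]) h1 h).adjust rfl
      ?_ (by simp; lia)⟩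
    congr 1
    funext e
    simp only [Function.update_apply]
    split_ifs <;> simp_all

/-- Empty a tape. -/
def clearTape (w : Tape) : Code A R I :=
  .loop (.tape w) (.pop (.tape w) fun s _ => s)

theorem exec_clearTape (w : Tape) (s : Ctl A R) (m : Store A R I) :
    Exec (clearTape w) s m s { m with tape := update m.tape w [] }
      (2 * (m.tape w).length + 1) := by
  generalize hx : m.tape w = l
  induction l generalizing m with
  | nil =>
    refine (Exec.loop_nil (by simp [Store.toStacks, hx])).adjust rfl ?_ le_add_self
    rw [← hx]; simp
  | cons a l ih =>
    exact (Exec.loop_cons (by simp [Store.toStacks, hx]) (Exec.popTape w _ s m)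
      (ih _ (by simp [hx]))).adjust rfl (by simp) (by simp; lia)

/-! ### Writing facts -/

/-- A fact: a relation symbol with its arguments. -/
abbrev Fact (R : Type) : Type := R × List ℕ

/-- The written form of a list of arguments. -/
def writeArgs (R : Type) (xs : List ℕ) : List (Symb R) :=
  xs.flatMap fun x => List.replicate x (.inr true) ++ [.inr false]

/-- The written form of a fact. -/
def writeFact (f : Fact R) : List (Symb R) := writeArgs R f.2 ++ [.inl f.1]

theorem length_writeArgs_le {n : ℕ} {xs : List ℕ} (h : ∀ x ∈ xs, x ≤ n) :
    (writeArgs R xs).length ≤ xs.length * (n + 1) := by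
  induction xs with
  | nil => simp [writeArgs]
  | cons x xs ih =>
    have h1 := ih fun y hy => h y (List.mem_cons_of_mem _ hy)
    have h2 := h x List.mem_cons_self
    simp only [writeArgs, List.flatMap_cons, List.length_append, List.length_replicate,
      List.length_cons, List.length_nil] at h1 ⊢
    linarith

theorem length_writeFact_le {n : ℕ} {f : Fact R} (h : ∀ x ∈ f.2, x ≤ n) :
    (writeFact f).length ≤ f.2.length * (n + 1) + 1 := by
  have := length_writeArgs_le (R := R) h
  simp [writeFact, this]

theorem replicate_stroke_append {x y : ℕ} {l l' : List (Symb R)}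
    (h : List.replicate x (.inr true) ++ .inr false :: l =
      List.replicate y (.inr true) ++ .inr false :: l') : x = y ∧ l = l' := by
  induction x generalizing y with
  | zero => cases y <;> simp_all [List.replicate_succ]
  | succ x ih =>
    cases y with
    | zero => simp [List.replicate_succ] at h
    | succ y => simpa using ih (by simpa [List.replicate_succ] using h)

theorem writeFact_append {f g : Fact R} {l l' : List (Symb R)}
    (h : writeFact f ++ l = writeFact g ++ l') : f = g := by
  obtain ⟨r, xs⟩ := f
  obtain ⟨r', ys⟩ := g
  suffices r = r' ∧ xs = ys by simp [this]
  simp only [writeFact, List.append_assoc] at h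
  induction xs generalizing ys with
  | nil =>
    cases ys with
    | nil => simp [writeArgs] at h; simp [h.1]
    | cons y ys => cases y <;> simp [writeArgs, List.replicate_succ] at h
  | cons x xs ih =>
    cases ys with
    | nil => cases x <;> simp [writeArgs, List.replicate_succ] at h
    | cons y ys =>
      simp only [writeArgs, List.flatMap_cons, List.append_assoc, List.cons_append] at h
      obtain ⟨rfl, h⟩ := replicate_stroke_append h
      obtain ⟨rfl, rfl⟩ := ih ys (by simpa [writeArgs] using h)
      simp

theorem exists_writeFact_eq (f : Fact R) :
    ∃ u : List Bool, writeFact f = u.map .inr ++ [.inl f.1] := by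
  obtain ⟨r, xs⟩ := f
  refine ⟨xs.flatMap fun x => List.replicate x true ++ [false], ?_⟩
  simp [writeFact, writeArgs, List.map_flatMap]

theorem writeFact_prefix_iff {f g : Fact R} : writeFact f <+: writeFact g ↔ f = g := by
  constructor
  · rintro ⟨l, h⟩
    exact writeFact_append (l' := []) (by simpa using h)
  · rintro rfl
    exact List.prefix_rfl

/-- Put the value of a register, in unary, on the query tape. -/
def copyReg (i : I) : Code A R I :=
  .seq (.loop (.counter (.up i)) (.seq (.pop (.counter (.up i)) fun s _ => s)
      (.seq (.push (.counter .temp) fun _ => ()) (.push (.tape .query) fun _ => .inr true))))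
    (transfer .temp (.up i))

theorem exec_copyReg (i : I) (s : Ctl A R) (m : Store A R I) (hm : m.counter .temp = 0) :
    Exec (copyReg i) s m s
      { m with
        tape := update m.tape .query
          (List.replicate (m.counter (.up i)) (.inr true) ++ m.tape .query) }
      (7 * m.counter (.up i) + 2) := by
  have key : ∀ (x : ℕ) (m : Store A R I), m.counter (.up i) = x →
      Exec (.loop (.counter (.up i)) (.seq (.pop (.counter (.up i)) fun s _ => s)
      (.seq (.push (.counter .temp) fun _ => ()) (.push (.tape .query) fun _ => .inr true)))) s m s
      { m with
        counter := update (update m.counter (.up i) 0) .temp (x + m.counter .temp)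
        tape := update m.tape .query (List.replicate x (.inr true) ++ m.tape .query) }
      (4 * x + 1) := by
    intro x
    induction x with
    | zero =>
      intro m hx
      refine (Exec.loop_nil (by simp [Store.toStacks, hx])).adjust rfl ?_ le_add_self
      rw [(update_eq_self_iff (a := Counter.up i)).2 hx.symm]; simp
    | succ x ih =>
      intro m hx
      refine (Exec.loop_cons (by simp [Store.toStacks, hx]) ((Exec.popCounter _ s m).seq
        ((Exec.pushCounter _ _ _).seq (Exec.pushTape _ _ _ _))) (ih _ (by simp [hx]))).adjust rfl ?_
        (by lia)
      congr 1
      · funext e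
        simp only [Function.update_apply]
        split_ifs <;> simp_all
        lia
      · simp [List.replicate_succ']
  refine ((key _ m rfl).seq (exec_transfer (c := .temp) (d := .up i) (by simp) s _)).adjust rfl ?_
    (by simp [hm]; lia)
  congr 1
  funext e
  simp only [Function.update_apply]
  split_ifs <;> simp_all

/-- Put the values of registers on the query tape. -/
def writeRegs : List I → Code A R I
  | [] => nop
  | i :: is => .seq (writeRegs is) (.seq (.push (.tape .query) fun _ => .inr false) (copyReg i))

theorem exec_writeRegs (is : List I) (s : Ctl A R) (m : Store A R I) (n : ℕ)
    (hm : m.counter .temp = 0) (hn : ∀ i, m.counter (.up i) ≤ n) :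
    Exec (writeRegs is) s m s
      { m with
        tape := update m.tape .query
          (writeArgs R (is.map fun i => m.counter (.up i)) ++ m.tape .query) }
      (is.length * (7 * n + 3) + 1) := by
  induction is with
  | nil => exact (exec_nop s m).adjust rfl (by simp [writeArgs]) le_add_self
  | cons i is ih =>
    refine (ih.seq ((Exec.pushTape _ _ _ _).seq (exec_copyReg i s _ hm))).adjust rfl ?_ ?_
    · simp [writeArgs]
    · have := hn i
      simp only [List.length_cons]
      nlinarith

/-- Put a fact on the query tape, the relation symbol depending on the state. -/
def writeQuery (r : Ctl A R → R) (is : List I) : Code A R I :=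
  .seq (.push (.tape .query) fun s => .inl (r s)) (writeRegs is)

theorem exec_writeQuery (r : Ctl A R → R) (is : List I) (s : Ctl A R) (m : Store A R I) (n : ℕ)
    (hm : m.counter .temp = 0) (hn : ∀ i, m.counter (.up i) ≤ n) (hq : m.tape .query = []) :
    Exec (writeQuery r is) s m s
      { m with
        tape := update m.tape .query (writeFact (r s, is.map fun i => m.counter (.up i))) }
      (is.length * (7 * n + 3) + 2) :=
  ((Exec.pushTape .query (fun s => .inl (r s)) s m).seq (exec_writeRegs is s _ n hm hn)).adjust rfl
    (by simp [writeFact, hq]) (by lia)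

/-- Add a fact to the database, the relation symbol depending on the state. -/
def addFact (r : Ctl A R → R) (is : List I) : Code A R I :=
  .seq (writeQuery r is) (.seq (move .query .query') (move .query' .facts))

/-- The running time of `addFact` for a fact with `k` arguments. -/
def addTime (k n : ℕ) : ℕ :=
  k * (7 * n + 3) + 2 + 2 * (3 * (k * (n + 1) + 1) + 2)

theorem exec_addFact (r : Ctl A R → R) (is : List I) (s : Ctl A R) (m : Store A R I) (n : ℕ)
    (hm : m.counter .temp = 0) (hn : ∀ i, m.counter (.up i) ≤ n) (hq : m.tape .query = [])
    (hq' : m.tape .query' = []) :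
    Exec (addFact r is) s m { s with symb := none }
      { m with
        tape := update m.tape .facts
          (writeFact (r s, is.map fun i => m.counter (.up i)) ++ m.tape .facts) }
      (addTime is.length n) := by
  refine ((exec_writeQuery r is s m n hm hn hq).seq ((exec_move (by simp) s _).seq
    (exec_move (v := .query') (w := .facts) (by simp) _ _))).adjust rfl ?_ ?_
  · congr 1
    funext e
    cases e <;> simp [hq, hq']
  · have hl : (writeFact (r s, is.map fun i => m.counter (.up i))).length ≤
        is.length * (n + 1) + 1 := by
      simpa using length_writeFact_le (f := (r s, is.map fun i => m.counter (.up i))) (n := n)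
        (by simpa using fun i _ => hn i)
    simp [hq', addTime]
    lia

end StackMachine

namespace StackMachine

open Function

variable {A R I : Type} [DecidableEq R] [DecidableEq I]

/-! ### Looking up facts -/

/-- Read one symbol of the database and compare it with the next symbol of the query. At the end of
a fact, record whether it is the query, and rewind the query. -/
def scanSymbol : Code A R I :=
  .seq (.pop (.tape .facts) fun s o => { s with symb := o }) <|
  .seq (.push (.tape .facts') fun s => s.symb.getD (.inr true)) <|
  .seq (.pop (.tape .query) fun s o => { s with symb' := o, ok := s.ok && decide (o = s.symb) }) <|
  .seq (.ite (fun s => s.symb'.isSome) (.push (.tape .query') fun s => s.symb'.getD (.inr true))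
    nop) <|
  .ite (fun s => (s.symb.getD (.inr true)).isLeft)
    (.seq (.load fun s => { s with found := s.found || s.ok, ok := true }) (move .query' .query))
    nop

/-- The part of a configuration that changes when a symbol is read: the query, the part of it that
has been read, and the two flags. -/
structure ScanState (R : Type) where
  query : List (Symb R)
  query' : List (Symb R)
  ok : Bool
  found : Bool

/-- The effect of `scanSymbol`. -/
def ScanState.step (c : ScanState R) (x : Symb R) : ScanState R :=
  if x.isLeft then
    { query := (c.query.head?.toList ++ c.query').reverse ++ c.query.tail
      query' := []
      ok := true
      found := c.found || (c.ok && decide (c.query.head? = some x)) }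
  else
    { query := c.query.tail
      query' := c.query.head?.toList ++ c.query'
      ok := c.ok && decide (c.query.head? = some x)
      found := c.found }

theorem ScanState.length_step (c : ScanState R) (x : Symb R) :
    (c.step x).query.length + (c.step x).query'.length = c.query.length + c.query'.length := by
  obtain ⟨q, q', ok, found⟩ := c
  unfold step
  cases q <;> split_ifs <;> simp <;> lia

/-- The tapes during a scan. -/
def scanTape (mem mem' : List (Symb R)) (c : ScanState R) : Tape → List (Symb R)
  | .facts => mem
  | .facts' => mem'
  | .query => c.query
  | .query' => c.query'

theorem exec_scanSymbol (s : Ctl A R) (m : Store A R I) (x : Symb R) (mem mem' : List (Symb R))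
    (c : ScanState R) (hok : s.ok = c.ok) (hfound : s.found = c.found) :
    ∃ s' : Ctl A R, s'.ok = (c.step x).ok ∧ s'.found = (c.step x).found ∧
      Exec scanSymbol s { m with tape := scanTape (x :: mem) mem' c } s'
        { m with tape := scanTape mem (x :: mem') (c.step x) }
        (3 * (c.query.length + c.query'.length) + 10) := by
  obtain ⟨q, q', ok, found⟩ := c
  obtain ⟨l, sy, sy', ok, found⟩ := s
  obtain rfl : ok = _ := hok
  obtain rfl : found = _ := hfound
  have e2 : Exec (.ite (fun s => s.symb'.isSome)
      (.push (.tape .query') fun s => s.symb'.getD (.inr true)) nop)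
      ⟨l, some x, q.head?, ok && decide (q.head? = some x), found⟩
      { m with tape := scanTape mem (x :: mem') ⟨q.tail, q', ok, found⟩ }
      ⟨l, some x, q.head?, ok && decide (q.head? = some x), found⟩
      { m with tape := scanTape mem (x :: mem') ⟨q.tail, q.head?.toList ++ q', ok, found⟩ } 2 := by
    cases q with
    | nil => exact Exec.ite_false rfl (exec_nop _ _)
    | cons y q =>
      refine (Exec.ite_true rfl (Exec.pushTape _ _ _ _)).adjust rfl ?_ le_rfl
      congr 1
      funext w
      cases w <;> simp [scanTape]
  have e1 : ∀ {s' m' p t}, Exec p ⟨l, some x, q.head?, ok && decide (q.head? = some x), found⟩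
      { m with tape := scanTape mem (x :: mem') ⟨q.tail, q.head?.toList ++ q', ok, found⟩ }
      s' m' t → Exec (.seq (.pop (.tape .facts) fun s o => { s with symb := o }) <|
        .seq (.push (.tape .facts') fun s => s.symb.getD (.inr true)) <|
        .seq (.pop (.tape .query) fun s o =>
          { s with symb' := o, ok := s.ok && decide (o = s.symb) }) <|
        .seq (.ite (fun s => s.symb'.isSome)
          (.push (.tape .query') fun s => s.symb'.getD (.inr true)) nop) p)
      ⟨l, sy, sy', ok, found⟩ { m with tape := scanTape (x :: mem) mem' ⟨q, q', ok, found⟩ }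
      s' m' (5 + t) := by
    intro s' m' p t h
    have h1 : ({ m with tape := scanTape mem (x :: mem') ⟨q.tail, q', ok, found⟩ } : Store A R I) =
        { m with tape := update (update (update (scanTape (x :: mem) mem' ⟨q, q', ok, found⟩)
          .facts mem) .facts' (x :: mem')) .query q.tail } := by
      congr 1
      funext w
      cases w <;> simp [scanTape]
    rw [h1] at e2
    have := (Exec.popTape .facts (fun s o => { s with symb := o })
      (⟨l, sy, sy', ok, found⟩ : Ctl A R)
      { m with tape := scanTape (x :: mem) mem' ⟨q, q', ok, found⟩ }).seq
      ((Exec.pushTape .facts' (fun s => s.symb.getD (.inr true)) _ _).seq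
      ((Exec.popTape .query (fun s o => { s with symb' := o, ok := s.ok && decide (o = s.symb) })
        _ _).seq (e2.seq h)))
    exact this.mono (by lia)
  unfold scanSymbol
  rcases x with r | b
  · refine ⟨_, ?_, ?_, (e1 (Exec.ite_true rfl ((Exec.load _ _ _).seq
      (exec_move (by simp) _ _)))).adjust rfl ?_ ?_⟩
    · simp [ScanState.step]
    · simp [ScanState.step]
    · congr 1
      funext w
      cases w <;> simp [scanTape, ScanState.step]
    · cases q <;> simp [scanTape] <;> lia
  · refine ⟨_, ?_, ?_, (e1 (Exec.ite_false rfl (exec_nop _ _))).adjust rfl ?_ ?_⟩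
    · simp [ScanState.step]
    · simp [ScanState.step]
    · congr 1
    · lia

theorem exec_scan (s : Ctl A R) (m : Store A R I) (mem mem' : List (Symb R)) (c : ScanState R)
    (hok : s.ok = c.ok) (hfound : s.found = c.found) :
    ∃ s' : Ctl A R, s'.found = (mem.foldl ScanState.step c).found ∧
      Exec (.loop (.tape .facts) scanSymbol) s { m with tape := scanTape mem mem' c } s'
        { m with tape := scanTape [] (mem.reverse ++ mem') (mem.foldl ScanState.step c) }
        (mem.length * (3 * (c.query.length + c.query'.length) + 11) + 1) := by
  induction mem generalizing s mem' c with
  | nil => exact ⟨s, hfound, (Exec.loop_nil rfl).mono (by simp)⟩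
  | cons x mem ih =>
    obtain ⟨s1, hok1, hfound1, h1⟩ := exec_scanSymbol s m x mem mem' c hok hfound
    obtain ⟨s2, hfound2, h2⟩ := ih s1 (x :: mem') (c.step x) hok1 hfound1
    refine ⟨s2, hfound2, (Exec.loop_cons (by simp [Store.toStacks, scanTape]) h1 h2).adjust rfl
      (by simp) ?_⟩
    rw [ScanState.length_step, List.length_cons]
    lia

/-- While the strokes and separators of a fact are read, its letters are compared with the query;
the terminating relation symbol records the outcome and rewinds the query. -/
theorem foldl_step_word (u : List Bool) (r : R) (q q' : List (Symb R)) (ok found : Bool) :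
    (u.map Sum.inr ++ [Sum.inl r]).foldl ScanState.step ⟨q, q', ok, found⟩ =
      ⟨q'.reverse ++ q, [], true,
        found || (ok && decide (u.map Sum.inr ++ [Sum.inl r] <+: q))⟩ := by
  induction u generalizing q q' ok with
  | nil =>
    cases q with
    | nil => simp [ScanState.step]
    | cons y q => simp [ScanState.step, eq_comm (a := y)]
  | cons b u ih =>
    simp only [List.map_cons, List.cons_append, List.foldl_cons]
    have : ScanState.step ⟨q, q', ok, found⟩ (.inr b : Symb R) =
      ⟨q.tail, q.head?.toList ++ q', ok && decide (q.head? = some (.inr b)), found⟩ := rfl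
    rw [this, ih]
    cases q with
    | nil => simp
    | cons y q =>
      simp [Bool.and_assoc, eq_comm (a := y)]
      congr

theorem foldl_step_facts (F : List (Fact R)) (g : Fact R) (found : Bool) :
    (F.flatMap writeFact).foldl ScanState.step ⟨writeFact g, [], true, found⟩ =
      ⟨writeFact g, [], true, found || decide (g ∈ F)⟩ := by
  induction F generalizing found with
  | nil => simp
  | cons f F ih =>
    obtain ⟨u, hu⟩ := exists_writeFact_eq f
    have : decide (u.map Sum.inr ++ [Sum.inl f.1] <+: writeFact g) = decide (g = f) := by
      simp [← hu, writeFact_prefix_iff, eq_comm (a := g)]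
    rw [List.flatMap_cons, List.foldl_append, hu, foldl_step_word, this]
    simp [ih, Bool.or_assoc]

/-- The store that represents the database `F` and the values `ρ` of the registers. -/
def dbStore (A : Type) (n : ℕ) (ρ : I → ℕ) (F : List (Fact R)) : Store A R I where
  input := []
  output := []
  counter
    | .up i => ρ i
    | .down i => n - ρ i
    | .temp => 0
  tape
    | .facts => F.flatMap writeFact
    | _ => []

/-- Look up a fact. -/
def lookup (r : R) (is : List I) : Code A R I :=
  .seq (.load fun s => { s with ok := true, found := false }) <|
  .seq (writeQuery (fun _ => r) is) <|
  .seq (.loop (.tape .facts) scanSymbol) <|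
  .seq (move .facts' .facts) (clearTape .query)

/-- The running time of `lookup` for a fact with `k` arguments in a database written with `B`
symbols. -/
def lookupTime (k n B : ℕ) : ℕ :=
  (k * (7 * n + 3) + 3) + (B * (3 * (k * (n + 1) + 1) + 11) + 1) + (3 * B + 2) +
    (2 * (k * (n + 1) + 1) + 1)

theorem exec_lookup (r : R) (is : List I) (s : Ctl A R) (n B : ℕ) (ρ : I → ℕ)
    (F : List (Fact R)) (hρ : ∀ i, ρ i ≤ n) (hB : (F.flatMap writeFact).length ≤ B) :
    ∃ s' : Ctl A R, s'.found = decide ((r, is.map ρ) ∈ F) ∧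
      Exec (lookup r is) s (dbStore A n ρ F) s' (dbStore A n ρ F) (lookupTime is.length n B) := by
  set g : Fact R := (r, is.map ρ) with hg
  have hl : (writeFact g).length ≤ is.length * (n + 1) + 1 := by
    simpa [hg] using length_writeFact_le (f := g) (n := n) (by simpa [hg] using fun i _ => hρ i)
  have h1 := exec_writeQuery (fun _ => r) is { s with ok := true, found := false }
    (dbStore A n ρ F) n rfl hρ rfl
  obtain ⟨s', hs', h2⟩ := exec_scan { s with ok := true, found := false } (dbStore A n ρ F)
    (F.flatMap writeFact) [] ⟨writeFact g, [], true, false⟩ rfl rfl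
  rw [foldl_step_facts] at hs' h2
  refine ⟨{ s' with symb := none }, by simpa using hs', ((Exec.load _ _ _).seq ((h1.adjust rfl ?_
    le_rfl).seq (h2.seq ((exec_move (by simp) _ _).seq (exec_clearTape _ _ _))))).adjust rfl ?_ ?_⟩
  · congr 1
    funext w
    cases w <;> simp [scanTape, dbStore, hg]
  · simp only [dbStore]
    congr 1
    funext w
    cases w <;> simp [scanTape]
  · have := Nat.mul_le_mul hB (show 3 * (writeFact g).length + 11 ≤
      3 * (is.length * (n + 1) + 1) + 11 by lia)
    simp only [scanTape, lookupTime, List.length_append, List.length_reverse, List.length_nil,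
      update_apply, add_zero, reduceCtorEq, if_false] at this ⊢
    lia

end StackMachine

namespace StackMachine

open Function

/-! ### Database programs -/

theorem foldl_invariant {α β : Type} (P : α → Prop) (f : α → β → α) (h : ∀ a x, P a → P (f a x))
    (l : List β) (a : α) (ha : P a) : P (l.foldl f a) := by
  induction l generalizing a with
  | nil => exact ha
  | cons x l ih => exact ih _ (h a x ha)

/-- The number of symbols with which a database is written. -/
def size {R : Type} (F : List (Fact R)) : ℕ := (F.flatMap writeFact).length

theorem size_mono {R : Type} {F G : List (Fact R)} (h : F <:+ G) : size F ≤ size G := by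
  obtain ⟨l, rfl⟩ := h
  simp [size]

variable {A R I : Type} [DecidableEq R] [DecidableEq I]

/-- Programs that extend a database of facts. Registers hold elements of a universe
`{0, …, n}`; `loop i c` runs `c` for each value of the register `i`, and `guard r is c` runs `c` if
the fact with relation symbol `r` whose arguments are in the registers `is` is in the database. -/
inductive Cmd (R I : Type)
  | skip
  | add (r : R) (is : List I)
  | seq (c d : Cmd R I)
  | guard (r : R) (is : List I) (c : Cmd R I)
  | loop (i : I) (c : Cmd R I)

namespace Cmd

/-- The database after running a program with values `ρ` of the registers. -/
def run (n : ℕ) : Cmd R I → (I → ℕ) → List (Fact R) → List (Fact R)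
  | skip, _, F => F
  | add r is, ρ, F => (r, is.map ρ) :: F
  | seq c d, ρ, F => d.run n ρ (c.run n ρ F)
  | guard r is c, ρ, F => if (r, is.map ρ) ∈ F then c.run n ρ F else F
  | loop i c, ρ, F => (List.range (n + 1)).foldl (fun F x => c.run n (update ρ i x) F) F

/-- A register is not used for two nested loops. -/
def Nested : Cmd R I → List I → Prop
  | skip, _ | add _ _, _ => True
  | seq c d, used => c.Nested used ∧ d.Nested used
  | guard _ _ c, used => c.Nested used
  | loop i c, used => i ∉ used ∧ c.Nested (i :: used)

/-- The machine program for a database program. -/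
def compile : Cmd R I → Code A R I
  | skip => nop
  | add r is => addFact (fun _ => r) is
  | seq c d => .seq c.compile d.compile
  | guard r is c => .seq (lookup r is) (.ite (fun s => s.found) c.compile nop)
  | loop i c => .seq c.compile <| .seq
      (.loop (.counter (.down i)) (.seq (.pop (.counter (.down i)) fun s _ => s)
        (.seq (.push (.counter (.up i)) fun _ => ()) c.compile)))
      (transfer (.up i) (.down i))

/-- A bound for the running time, if the database is written with at most `B` symbols. -/
def time (n B : ℕ) : Cmd R I → ℕ
  | skip => 1
  | add _ is => addTime is.length n
  | seq c d => c.time n B + d.time n B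
  | guard _ is c => lookupTime is.length n B + (c.time n B + 2)
  | loop _ c => (n + 1) * (c.time n B + 3) + (3 * n + 2)

/-- A bound for the number of symbols that a program adds to the database. -/
def growth (n : ℕ) : Cmd R I → ℕ
  | skip => 0
  | add _ is => is.length * (n + 1) + 1
  | seq c d => c.growth n + d.growth n
  | guard _ _ c => c.growth n
  | loop _ c => (n + 1) * c.growth n

theorem suffix_run (n : ℕ) (c : Cmd R I) (ρ : I → ℕ) (F : List (Fact R)) : F <:+ c.run n ρ F := by
  induction c generalizing ρ F with
  | skip => exact List.suffix_rfl
  | add r is => exact List.suffix_cons _ _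
  | seq c d ihc ihd => exact (ihc ρ F).trans (ihd ρ _)
  | guard r is c ih =>
    unfold run
    split_ifs
    · exact ih ρ F
    · exact List.suffix_rfl
  | loop i c ih =>
    exact foldl_invariant (fun G => F <:+ G) _ (fun G x h => h.trans (ih _ G)) _ F List.suffix_rfl

theorem size_run_le (n : ℕ) (c : Cmd R I) (ρ : I → ℕ) (hρ : ∀ i, ρ i ≤ n) (F : List (Fact R)) :
    size (c.run n ρ F) ≤ size F + c.growth n := by
  induction c generalizing ρ F with
  | skip => simp [run]
  | add r is =>
    have := length_writeFact_le (f := (r, is.map ρ)) (n := n) (by simpa using fun i _ => hρ i)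
    simp [run, size, growth] at this ⊢
    lia
  | seq c d ihc ihd =>
    have h1 := ihc ρ hρ F
    have h2 := ihd ρ hρ (c.run n ρ F)
    simp only [run, growth]
    lia
  | guard r is c ih =>
    unfold run
    split_ifs
    · exact ih ρ hρ F
    · simp
  | loop i c ih =>
    have key : ∀ (l : List ℕ) (F : List (Fact R)), (∀ x ∈ l, x ≤ n) →
        size (l.foldl (fun F x => c.run n (update ρ i x) F) F) ≤
          size F + l.length * c.growth n := by
      intro l
      induction l with
      | nil => simp
      | cons x l ihl =>
        intro F hl
        have h1 := ihl (c.run n (update ρ i x) F) fun y hy => hl y (List.mem_cons_of_mem _ hy)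
        have h2 := ih (update ρ i x) (fun j => by
          by_cases h : j = i
          · subst h; simpa using hl x List.mem_cons_self
          · simpa [h] using hρ j) F
        simp only [List.foldl_cons, List.length_cons]
        lia
    simpa [run, growth] using key (List.range (n + 1)) F (by simp)

/-- The machine program for a database program does what the database program does. -/
theorem exec_compile (n B : ℕ) (c : Cmd R I) (used : List I) (hc : c.Nested used) (ρ : I → ℕ)
    (hρ : ∀ i, ρ i ≤ n) (h0 : ∀ i ∉ used, ρ i = 0) (F : List (Fact R))
    (hB : size (c.run n ρ F) ≤ B) (s : Ctl A R) :
    ∃ s', Exec c.compile s (dbStore A n ρ F) s' (dbStore A n ρ (c.run n ρ F)) (c.time n B) := by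
  induction c generalizing used ρ F s with
  | skip => exact ⟨_, exec_nop _ _⟩
  | add r is =>
    refine ⟨_, (exec_addFact _ is s (dbStore A n ρ F) n rfl hρ rfl rfl).adjust rfl ?_ le_rfl⟩
    simp only [dbStore, run]
    congr 1
    funext w
    cases w <;> simp
  | seq c d ihc ihd =>
    obtain ⟨s1, h1⟩ := ihc used hc.1 ρ hρ h0 F ((size_mono (suffix_run n d ρ _)).trans hB) s
    obtain ⟨s2, h2⟩ := ihd used hc.2 ρ hρ h0 (c.run n ρ F) hB s1
    exact ⟨s2, h1.seq h2⟩
  | guard r is c ih =>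
    obtain ⟨s1, hs1, h1⟩ := exec_lookup r is s n B ρ F hρ
      ((size_mono (suffix_run n (guard r is c) ρ F)).trans hB)
    by_cases h : (r, is.map ρ) ∈ F
    · simp only [run, if_pos h] at hB ⊢
      obtain ⟨s2, h2⟩ := ih used hc ρ hρ h0 F hB s1
      refine ⟨s2, (h1.seq (Exec.ite_true (by simp [hs1, h]) h2)).mono ?_⟩
      simp only [time]
      lia
    · simp only [run, if_neg h]
      refine ⟨s1, (h1.seq (Exec.ite_false (by simp [hs1, h]) (exec_nop _ _))).mono ?_⟩
      simp only [time]
      lia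
  | loop i c ih =>
    have hi : ρ i = 0 := h0 i hc.1
    -- one run of the body, for the value `x` of the register
    have body : ∀ x ≤ n, ∀ (F : List (Fact R)), size (c.run n (update ρ i x) F) ≤ B →
        ∀ s, ∃ s', Exec c.compile s (dbStore A n (update ρ i x) F) s'
          (dbStore A n (update ρ i x) (c.run n (update ρ i x) F)) (c.time n B) := by
      intro x hx F hF s
      refine ih (i :: used) hc.2 (update ρ i x) (fun j => ?_) (fun j hj => ?_) F hF s
      · by_cases h : j = i
        · subst h; simpa using hx
        · simpa [h] using hρ j
      · simp only [List.mem_cons, not_or] at hj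
        simpa [hj.1] using h0 j hj.2
    -- the remaining runs, after the one for the value `x`
    have rest : ∀ d x, x + d = n → ∀ (F : List (Fact R)),
        size ((List.range' (x + 1) d).foldl (fun F x => c.run n (update ρ i x) F) F) ≤ B →
        ∀ s, ∃ s', Exec (.loop (.counter (.down i)) (.seq (.pop (.counter (.down i)) fun s _ => s)
          (.seq (.push (.counter (.up i)) fun _ => ()) c.compile))) s
          (dbStore A n (update ρ i x) F) s' (dbStore A n (update ρ i n)
            ((List.range' (x + 1) d).foldl (fun F x => c.run n (update ρ i x) F) F))
          (d * (c.time n B + 3) + 1) := by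
      intro d
      induction d with
      | zero =>
        intro x hx F hF s
        obtain rfl : x = n := hx
        exact ⟨s, (Exec.loop_nil (by simp [Store.toStacks, dbStore])).adjust rfl rfl (by simp)⟩
      | succ d ihd =>
        intro x hx F hF s
        rw [List.range'_succ, List.foldl_cons] at hF ⊢
        obtain ⟨s1, h1⟩ := body (x + 1) (by lia) F ((size_mono (foldl_invariant
          (fun G => c.run n (update ρ i (x + 1)) F <:+ G) _
          (fun G x h => h.trans (suffix_run n c _ G)) _ _ List.suffix_rfl)).trans hF) s
        obtain ⟨s2, h2⟩ := ihd (x + 1) (by lia) _ hF s1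
        have e : dbStore A n (update ρ i (x + 1)) F =
            { dbStore A n (update ρ i x) F with
              counter := update (update (dbStore A n (update ρ i x) F).counter (.down i)
                ((dbStore A n (update ρ i x) F).counter (.down i) - 1)) (.up i)
                (update (dbStore A n (update ρ i x) F).counter (.down i)
                ((dbStore A n (update ρ i x) F).counter (.down i) - 1) (.up i) + 1) } := by
          simp only [dbStore]
          congr 1
          funext k
          rcases k with j | j | _
          · by_cases h : j = i
            · subst h; simp
            · simp [h]
          · by_cases h : j = i
            · subst h; simp; lia
            · simp [h]
          · simp
        rw [e] at h1
        refine ⟨s2, (Exec.loop_cons ?_ ((Exec.popCounter _ s _).seq ((Exec.pushCounter _ s _).seq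
          h1)) h2).mono ?_⟩
        · simp [Store.toStacks, dbStore]
          lia
        · lia
    have hr : (List.range (n + 1)).foldl (fun F x => c.run n (update ρ i x) F) F =
        (List.range' (0 + 1) n).foldl (fun F x => c.run n (update ρ i x) F)
          (c.run n (update ρ i 0) F) := by
      rw [List.range_eq_range', List.range'_succ, List.foldl_cons]
    simp only [run] at hB ⊢
    rw [hr] at hB ⊢
    obtain ⟨s1, h1⟩ := body 0 (Nat.zero_le n) F ((size_mono (foldl_invariant
      (fun G => c.run n (update ρ i 0) F <:+ G) _
      (fun G x h => h.trans (suffix_run n c _ G)) _ _ List.suffix_rfl)).trans hB) s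
    obtain ⟨s2, h2⟩ := rest n 0 (by simp) _ hB s1
    rw [update_eq_self_iff.2 hi.symm] at h1 h2 ⊢
    refine ⟨s2, (h1.seq (h2.seq (exec_transfer (c := .up i) (d := .down i) (by simp) s2 _))).adjust
      rfl ?_ ?_⟩
    · simp only [dbStore]
      congr 1
      funext k
      rcases k with j | j | _
      · by_cases h : j = i
        · subst h; simp [hi]
        · simp [h]
      · by_cases h : j = i
        · subst h; simp [hi]
        · simp [h]
      · simp
    · simp [time, dbStore]
      lia

end Cmd

end StackMachine

namespace StackMachine

open Function

/-! ### Polynomial bounds -/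

/-- A function that is bounded by a polynomial. -/
def PolyBounded (f : ℕ → ℕ) : Prop := ∃ p : Polynomial ℕ, ∀ n, f n ≤ p.eval n

namespace PolyBounded

variable {f g : ℕ → ℕ}

theorem const (k : ℕ) : PolyBounded fun _ => k := ⟨.C k, by simp⟩

theorem id : PolyBounded fun n => n := ⟨.X, by simp⟩

theorem add (hf : PolyBounded f) (hg : PolyBounded g) : PolyBounded fun n => f n + g n :=
  let ⟨p, hp⟩ := hf
  let ⟨q, hq⟩ := hg
  ⟨p + q, fun n => by simpa using add_le_add (hp n) (hq n)⟩

theorem mul (hf : PolyBounded f) (hg : PolyBounded g) : PolyBounded fun n => f n * g n :=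
  let ⟨p, hp⟩ := hf
  let ⟨q, hq⟩ := hg
  ⟨p * q, fun n => by simpa using Nat.mul_le_mul (hp n) (hq n)⟩

theorem addTime (k : ℕ) (hf : PolyBounded f) : PolyBounded fun n => addTime k (f n) := by
  unfold StackMachine.addTime
  repeat' first | exact hf | exact const _ | apply add | apply mul

theorem lookupTime (k : ℕ) (hf : PolyBounded f) (hg : PolyBounded g) :
    PolyBounded fun n => lookupTime k (f n) (g n) := by
  unfold StackMachine.lookupTime
  repeat' first | exact hf | exact hg | exact const _ | apply add | apply mul

theorem growth {R I : Type} (c : Cmd R I) : PolyBounded fun n => c.growth n := by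
  induction c with
  | skip => exact const 0
  | add r is => exact add (mul (const _) (add id (const _))) (const _)
  | seq c d ihc ihd => exact add ihc ihd
  | guard r is c ih => exact ih
  | loop i c ih => exact mul (add id (const _)) ih

theorem time {R I : Type} (c : Cmd R I) (hf : PolyBounded f) :
    PolyBounded fun n => c.time n (f n) := by
  induction c with
  | skip => exact const 1
  | add r is => exact addTime _ id
  | seq c d ihc ihd => exact add ihc ihd
  | guard r is c ih => exact add (lookupTime _ id hf) (add ih (const 2))
  | loop i c ih =>
    exact add (mul (add id (const 1)) (add ih (const 3))) (add (mul (const 3) id) (const 2))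

end PolyBounded

/-! ### Reading the input and writing the answer -/

/-- The facts that describe a word: the letter `a` leads from its position to the next one. -/
def readFacts {A R : Type} (edge : A → R) : List A → ℕ → List (Fact R) → List (Fact R)
  | [], _, F => F
  | a :: w, p, F => readFacts edge w (p + 1) ((edge a, [p, p + 1]) :: F)

/-- The database that describes a word: its letters, and the first and the last position. -/
def wordFacts {A R : Type} (edge : A → R) (zero last : R) (w : List A) : List (Fact R) :=
  (last, [w.length]) :: readFacts edge w 0 [(zero, [0])]

theorem mem_readFacts {A R : Type} {edge : A → R} {w : List A} {p : ℕ} {F : List (Fact R)}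
    {f : Fact R} : f ∈ readFacts edge w p F ↔
      f ∈ F ∨ ∃ k a, w[k]? = some a ∧ f = (edge a, [p + k, p + k + 1]) := by
  induction w generalizing p F with
  | nil => simp [readFacts]
  | cons a w ih =>
    rw [readFacts, ih, List.mem_cons]
    constructor
    · rintro ((rfl | h) | ⟨k, b, hk, rfl⟩)
      · exact .inr ⟨0, a, by simp⟩
      · exact .inl h
      · exact .inr ⟨k + 1, b, by simpa using hk, by simp; lia⟩
    · rintro (h | ⟨k, b, hk, rfl⟩)
      · exact .inl (.inr h)
      · cases k with
        | zero => simp at hk; subst hk; exact .inl (.inl (by simp))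
        | succ k => exact .inr ⟨k, b, by simpa using hk, by simp; lia⟩

theorem size_readFacts_le {A R : Type} (edge : A → R) (w : List A) (p N : ℕ)
    (hN : p + w.length ≤ N) (F : List (Fact R)) :
    size (readFacts edge w p F) ≤ size F + w.length * (2 * (N + 1) + 1) := by
  induction w generalizing p F with
  | nil => simp [readFacts]
  | cons a w ih =>
    simp only [List.length_cons] at hN ⊢
    have h1 := ih (p + 1) (by lia) ((edge a, [p, p + 1]) :: F)
    have h2 := length_writeFact_le (f := (edge a, [p, p + 1])) (n := N) (by simp; lia)
    simp only [size, List.flatMap_cons, List.length_append, List.length_cons,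
      List.length_nil] at h1 h2
    simp only [readFacts, size]
    lia

theorem size_wordFacts_le {A R : Type} (edge : A → R) (zero last : R) (w : List A) :
    size (wordFacts edge zero last w) ≤ (w.length + 2) * (2 * (w.length + 1) + 1) := by
  have h1 := size_readFacts_le edge w 0 w.length (by simp) [(zero, [0])]
  have h2 := length_writeFact_le (f := (last, [w.length])) (n := w.length) (by simp)
  simp only [wordFacts, size, List.flatMap_cons, List.length_append] at h1 h2 ⊢
  simp [writeFact, writeArgs] at h1 h2 ⊢
  lia

variable {A R I : Type} [DecidableEq I]

/-- Increment the counters `down i` for the given registers. -/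
def fill : List I → Code A R I
  | [] => nop
  | i :: l => .seq (.push (.counter (.down i)) fun _ => ()) (fill l)

theorem exec_fill (l : List I) (s : Ctl A R) (m : Store A R I) :
    Exec (fill l) s m s
      { m with
        counter := fun
          | .down i => m.counter (.down i) + l.count i
          | c => m.counter c } (l.length + 1) := by
  induction l generalizing m with
  | nil =>
    refine (exec_nop s m).adjust rfl ?_ le_add_self
    obtain ⟨_, _, _, _⟩ := m
    congr 1
    funext c
    cases c <;> simp
  | cons i l ih =>
    refine ((Exec.pushCounter _ s m).seq (ih _)).adjust rfl ?_ (by simp; lia)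
    congr 1
    funext c
    rcases c with j | j | _
    · simp
    · by_cases h : j = i
      · subst h; simp; lia
      · simp [h, Ne.symm h]
    · simp

/-- Empty the counters `down i` for the given registers. -/
def clearDown : List I → Code A R I
  | [] => nop
  | i :: l => .seq (clearCounter (.down i)) (clearDown l)

theorem exec_clearDown (l : List I) (s : Ctl A R) (m : Store A R I) (n : ℕ)
    (hn : ∀ i, m.counter (.down i) ≤ n) :
    Exec (clearDown l) s m s
      { m with
        counter := fun
          | .down i => if i ∈ l then 0 else m.counter (.down i)
          | c => m.counter c } (l.length * (2 * n + 1) + 1) := by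
  induction l generalizing m with
  | nil =>
    refine (exec_nop s m).adjust rfl ?_ le_add_self
    obtain ⟨_, _, _, _⟩ := m
    congr 1
    funext c
    cases c <;> simp
  | cons i l ih =>
    refine ((exec_clearCounter _ s m).seq (ih _ fun j => ?_)).adjust rfl ?_ ?_
    · by_cases h : j = i
      · subst h; simp
      · simpa [h] using hn j
    · congr 1
      funext c
      rcases c with j | j | _
      · simp
      · by_cases h : j = i
        · subst h; simp
        · simp [h]
      · simp
    · have := hn i
      simp only [List.length_cons]
      lia

/-- The relation symbol for the letter that has been read. -/
def letterRel (edge : A → R) (zero : R) (s : Ctl A R) : R := s.letter.elim zero edge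

/-- Replace the input by the database that describes it, and initialize the registers. -/
noncomputable def readInput [Fintype I] (edge : A → R) (zero last : R) (i₀ i₁ : I) : Code A R I :=
  .seq (.push (.counter (.up i₁)) fun _ => ()) <|
  .seq (addFact (fun _ => zero) [i₀]) <|
  .seq (.loop .input <|
    .seq (.pop .input fun s o => { s with letter := o }) <|
    .seq (addFact (letterRel edge zero) [i₀, i₁]) <|
    .seq (.push (.counter (.up i₀)) fun _ => ()) <|
    .seq (.push (.counter (.up i₁)) fun _ => ()) <|
    fill Finset.univ.toList) <|
  .seq (addFact (fun _ => last) [i₀]) <|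
  .seq (clearCounter (.up i₀)) (clearCounter (.up i₁))

/-- The running time of `readInput` for words of length `n`, with `v` registers. -/
def readTime (v n : ℕ) : ℕ :=
  1 + (addTime 1 (n + 1) + ((n * (addTime 2 (n + 1) + v + 5) + 1) + (addTime 1 (n + 1) +
    ((2 * n + 1) + (2 * (n + 1) + 1)))))

/-- The store while the input is read: `w` is what remains, `p` is the position. -/
def readStore (i₀ i₁ : I) (w : List A) (p : ℕ) (F : List (Fact R)) : Store A R I where
  input := w
  output := []
  counter
    | .up i => if i = i₀ then p else if i = i₁ then p + 1 else 0
    | .down _ => p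
    | .temp => 0
  tape
    | .facts => F.flatMap writeFact
    | _ => []

theorem exec_addFact_readStore {i₀ i₁ : I} (w : List A) (p n : ℕ) (hp : p ≤ n) (F : List (Fact R))
    (r : Ctl A R → R) (is : List I) (s : Ctl A R) :
    Exec (addFact r is) s (readStore i₀ i₁ w p F) { s with symb := none }
      (readStore i₀ i₁ w p
        ((r s, is.map fun i => if i = i₀ then p else if i = i₁ then p + 1 else 0) :: F))
      (addTime is.length (n + 1)) := by
  refine (exec_addFact r is s (readStore i₀ i₁ w p F) (n + 1) rfl ?_ rfl rfl).adjust rfl ?_ le_rfl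
  · intro i
    simp only [readStore]
    split_ifs <;> lia
  · simp only [readStore]
    congr 1
    funext v
    cases v <;> simp

theorem exec_readInput [Fintype I] (edge : A → R) (zero last : R) {i₀ i₁ : I} (h01 : i₀ ≠ i₁)
    (w : List A) (s : Ctl A R) : ∃ s',
    Exec (readInput edge zero last i₀ i₁) s
      { input := w, output := [], counter := fun _ => 0, tape := fun _ => [] } s'
      (dbStore A w.length (fun _ => 0) (wordFacts edge zero last w))
      (readTime (Fintype.card I) w.length) := by
  have main : ∀ (n : ℕ) (w : List A) (p : ℕ) (F : List (Fact R)) (s : Ctl A R),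
      p + w.length = n → ∃ s', Exec (.loop .input <|
        .seq (.pop .input fun s o => { s with letter := o }) <|
        .seq (addFact (letterRel edge zero) [i₀, i₁]) <|
        .seq (.push (.counter (.up i₀)) fun _ => ()) <|
        .seq (.push (.counter (.up i₁)) fun _ => ()) <|
        fill Finset.univ.toList) s (readStore i₀ i₁ w p F) s'
        (readStore i₀ i₁ [] n (readFacts edge w p F))
        (w.length * (addTime 2 (n + 1) + Fintype.card I + 5) + 1) := by
    intro n w
    induction w with
    | nil =>
      intro p F s hp
      obtain rfl : p = n := hp
      exact ⟨s, (Exec.loop_nil rfl).mono (by simp)⟩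
    | cons a w ih =>
      intro p F s hp
      rw [List.length_cons] at hp
      have h1 := Exec.popInput (fun s o => { s with letter := o }) s (readStore i₀ i₁ (a :: w) p F)
      have h2 := exec_addFact_readStore (i₀ := i₀) (i₁ := i₁) w p n (by lia) F
        (letterRel edge zero) [i₀, i₁] { s with letter := some a }
      obtain ⟨s', h3⟩ := ih (p + 1) ((edge a, [p, p + 1]) :: F)
        { s with letter := some a, symb := none } (by lia)
      refine ⟨s', (Exec.loop_cons (by simp [Store.toStacks, readStore]) (h1.seq (h2.seq
        ((Exec.pushCounter _ _ _).seq ((Exec.pushCounter _ _ _).seq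
          ((exec_fill _ _ _).adjust rfl ?_ le_rfl))))) h3).mono ?_⟩
      · simp only [readStore]
        congr 1
        · funext c
          rcases c with j | j | _
          · by_cases hj0 : j = i₀
            · subst hj0; simp [h01]
            · by_cases hj1 : j = i₁
              · subst hj1; simp [hj0]
              · simp [hj0, hj1]
          · have : List.count j Finset.univ.toList = 1 :=
              List.count_eq_one_of_mem (Finset.nodup_toList _) (by simp)
            simp [this]
          · simp
        · simp [letterRel, h01.symm]
      · simp
        lia
  obtain ⟨s', h3⟩ := main w.length w 0 [(zero, [0])] { s with symb := none } (by simp)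
  have h1 := (Exec.pushCounter (.up i₁) s
    { input := w, output := [], counter := fun _ => 0, tape := fun _ => [] }).adjust
    (m'' := readStore (A := A) (R := R) i₀ i₁ w 0 []) rfl (by
      simp only [readStore]
      congr 1
      · funext c
        rcases c with j | j | _
        · by_cases hj1 : j = i₁
          · subst hj1; simp [h01.symm]
          · simp [hj1]
        · simp
        · simp
      · funext v
        cases v <;> simp) le_rfl
  have h2 := exec_addFact_readStore (i₀ := i₀) (i₁ := i₁) w 0 w.length (by simp) []
    (fun _ => zero) [i₀] s
  have h4 := exec_addFact_readStore (i₀ := i₀) (i₁ := i₁) ([] : List A) w.length w.length le_rfl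
    (readFacts edge w 0 [(zero, [0])]) (fun _ => last) [i₀] s'
  refine ⟨_, (h1.seq ((h2.adjust rfl (by simp) le_rfl).seq (h3.seq (h4.seq
    ((exec_clearCounter _ _ _).seq (exec_clearCounter _ _ _)))))).adjust rfl ?_ ?_⟩
  · simp only [readStore, dbStore]
    congr 1
    · funext c
      rcases c with j | j | _
      · by_cases hj0 : j = i₀
        · subst hj0; simp [h01]
        · by_cases hj1 : j = i₁
          · subst hj1; simp
          · simp [hj0, hj1]
      · simp
      · simp
    · funext v
      cases v <;> simp [wordFacts]
  · simp [readStore, readTime, h01.symm]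

variable [DecidableEq R]

/-- Output whether a fact without arguments is missing from the database, and empty all other
stacks. -/
noncomputable def writeAnswer [Fintype I] (fail : R) : Code A R I :=
  .seq (lookup fail []) <|
  .seq (clearTape .facts) <|
  .seq (clearDown Finset.univ.toList) (.push .output fun s => !s.found)

theorem exec_writeAnswer [Fintype I] (fail : R) (n B : ℕ) (F : List (Fact R)) (hB : size F ≤ B)
    (s : Ctl A R) : ∃ s', Exec (writeAnswer (I := I) fail) s (dbStore A n (fun _ => 0) F) s'
      { input := [], output := [!decide ((fail, []) ∈ F)], counter := fun _ => 0,
        tape := fun _ => [] }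
      (lookupTime 0 n B + ((2 * B + 1) + ((Fintype.card I * (2 * n + 1) + 1) + 1))) := by
  obtain ⟨s', hs', h⟩ := exec_lookup fail [] s n B (fun _ : I => 0) F (by simp) hB
  refine ⟨s', (h.seq ((exec_clearTape _ _ _).seq ((exec_clearDown _ _ _ n ?_).seq
    (Exec.pushOutput _ _ _)))).adjust rfl ?_ ?_⟩
  · simp [dbStore]
  · simp only [dbStore]
    congr 1
    · simp [hs']
    · funext c
      cases c <;> simp
    · funext v
      cases v <;> simp
  · have : ((dbStore A n (fun _ : I => 0) F).tape .facts).length ≤ B := hB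
    simp
    lia

/-- A property of words that a database program decides, by not deriving the fact `fail` from the
database that describes the word, is decidable in polynomial time. -/
theorem polyTime_of_cmd [Fintype A] [Fintype R] [Fintype I] (c : Cmd R I) (hc : c.Nested [])
    (edge : A → R) (zero last fail : R) {i₀ i₁ : I} (h01 : i₀ ≠ i₁) {α : Type} (ea : α → List A)
    (f : α → Bool) (hf : ∀ a, f a = true ↔ (fail, []) ∉
      c.run (ea a).length (fun _ => 0) (wordFacts edge zero last (ea a))) :
    Nonempty (Turing.TM2ComputableInPolyTime ea Computability.encodeBool f) := by
  set B : ℕ → ℕ := fun n => (n + 2) * (2 * (n + 1) + 1) + c.growth n with hBdef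
  have hB : PolyBounded B := by
    refine .add (.mul (.add .id (.const 2)) (.add (.mul (.const 2) (.add .id (.const 1)))
      (.const 1))) (.growth c)
  obtain ⟨time, htime⟩ : PolyBounded fun n => readTime (Fintype.card I) n + (c.time n (B n) +
      (lookupTime 0 n (B n) + ((2 * B n + 1) + ((Fintype.card I * (2 * n + 1) + 1) + 1)))) := by
    refine .add ?_ (.add (.time c hB) (.add (.lookupTime _ .id hB) ?_))
    · unfold readTime
      repeat' first
        | exact .id
        | exact .const _
        | apply PolyBounded.addTime
        | apply PolyBounded.add
        | apply PolyBounded.mul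
    · repeat' first | exact .id | exact .const _ | exact hB | apply PolyBounded.add |
        apply PolyBounded.mul
  have e1 : ∀ l : List A, update (β := fun k => List (alphabet A R I k)) (fun _ => []) .input l =
      Store.toStacks { input := l, output := [], counter := fun _ => 0, tape := fun _ => [] } := by
    intro l
    funext k
    cases k <;> simp [Store.toStacks]
  have e2 : ∀ l : List Bool,
      update (β := fun k => List (alphabet A R I k)) (fun _ => []) .output l =
      Store.toStacks { input := [], output := l, counter := fun _ => 0, tape := fun _ => [] } := by
    intro l
    funext k
    cases k <;> simp [Store.toStacks]
  refine Prog.polyTime_of_runsIn (K := Stack I) (Γ := alphabet A R I) (σ := Ctl A R)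
    (.seq (readInput edge zero last i₀ i₁) (.seq c.compile (writeAnswer fail)))
    ⟨none, none, none, false, false⟩ .input .output ea Computability.encodeBool f time fun a => ?_
  obtain ⟨s1, h1⟩ := exec_readInput edge zero last h01 (ea a) ⟨none, none, none, false, false⟩
  have hsize : size (c.run (ea a).length (fun _ => 0) (wordFacts edge zero last (ea a))) ≤
      B (ea a).length :=
    (Cmd.size_run_le _ c _ (by simp) _).trans
      (Nat.add_le_add_right (size_wordFacts_le edge zero last (ea a)) _)
  obtain ⟨s2, h2⟩ := Cmd.exec_compile (A := A) (ea a).length _ c [] hc (fun _ => 0) (by simp)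
    (by simp) _ hsize s1
  obtain ⟨s3, h3⟩ := exec_writeAnswer (I := I) fail (ea a).length _ _ hsize s2
  refine ⟨s3, ?_⟩
  have h := (h1.seq (h2.seq h3)).mono (htime (ea a).length)
  have hfa : f a = !decide ((fail, []) ∈
      c.run (ea a).length (fun _ => 0) (wordFacts edge zero last (ea a))) := by
    rw [Bool.eq_iff_iff, hf a]
    simp
  rw [e1, e2, hfa]
  exact h

end StackMachine

namespace StackMachine

open Function

/-! ### Horn rules -/

/-- A Horn rule over relation symbols `R` and variables `V`: the head holds if the atoms of the body
do. An atom is a relation symbol applied to variables. -/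
structure Rule (R V : Type) where
  body : List (R × List V)
  head : R × List V

/-- An atom, with values for its variables. -/
def inst {R V : Type} (ρ : V → ℕ) (a : R × List V) : Fact R := (a.1, a.2.map ρ)

/-- The facts derivable from `base` by the rules, with values of the variables in `{0, …, n}`. -/
inductive Derives {R V N : Type} (rule : N → Rule R V) (n : ℕ) (base : Set (Fact R)) :
    Fact R → Prop
  | base {f : Fact R} (hf : f ∈ base) : Derives rule n base f
  | step (k : N) (ρ : V → ℕ) (hρ : ∀ i, ρ i ≤ n)
      (h : ∀ a ∈ (rule k).body, Derives rule n base (inst ρ a)) :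
      Derives rule n base (inst ρ (rule k).head)

/-- The facts derivable in a given number of rounds; in each round, all rules are applied at
once. -/
def Within {R V N : Type} (rule : N → Rule R V) (n : ℕ) (base : Set (Fact R)) : ℕ → Set (Fact R)
  | 0 => base
  | t + 1 => {f | f ∈ Within rule n base t ∨ ∃ (k : N) (ρ : V → ℕ), (∀ i, ρ i ≤ n) ∧
      (∀ a ∈ (rule k).body, inst ρ a ∈ Within rule n base t) ∧ f = inst ρ (rule k).head}

theorem within_mono {R V N : Type} (rule : N → Rule R V) (n : ℕ) (base : Set (Fact R)) :
    Monotone (Within rule n base) :=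
  monotone_nat_of_le_succ fun _ _ h => .inl h

/-- Every derivable fact is derivable in at most as many rounds as there are instances of rules,
since otherwise each of these rounds would add another head of an instance. -/
theorem Derives.within {R V N : Type} [Fintype V] [Fintype N] {rule : N → Rule R V} {n : ℕ}
    {base : Set (Fact R)} {f : Fact R} (hf : Derives rule n base f) :
    f ∈ Within rule n base ((n + 1) ^ Fintype.card V * Fintype.card N) := by
  classical
  set W := Within rule n base with hW
  set T := (n + 1) ^ Fintype.card V * Fintype.card N with hT
  obtain ⟨t, ht, hst⟩ : ∃ t ≤ T, W (t + 1) ⊆ W t := by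
    by_contra! hcon
    have hnew : ∀ t, ∃ f, t ≤ T → f ∈ W (t + 1) ∧ f ∉ W t := by
      intro t
      by_cases ht : t ≤ T
      · obtain ⟨f, h1, h2⟩ := Set.not_subset.1 (hcon t ht)
        exact ⟨f, fun _ => ⟨h1, h2⟩⟩
      · exact ⟨f, fun h => absurd h ht⟩
    choose g hg using hnew
    set H : Finset (Fact R) := Finset.univ.image fun p : N × (V → Fin (n + 1)) =>
      inst (fun i => (p.2 i : ℕ)) (rule p.1).head with hH
    have hcard : H.card ≤ T := by
      refine Finset.card_image_le.trans ?_
      simp [hT, mul_comm]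
    have hmaps : ∀ t ∈ Finset.range (T + 1), g t ∈ H := by
      intro t ht
      obtain ⟨h1, h2⟩ := hg t (by simpa [Nat.lt_succ_iff] using ht)
      obtain h1 | ⟨k, ρ, hρ, -, h1⟩ := h1
      · exact absurd h1 h2
      · rw [h1, hH, Finset.mem_image]
        exact ⟨(k, fun i => ⟨ρ i, Nat.lt_succ_iff.2 (hρ i)⟩), Finset.mem_univ _, rfl⟩
    have hinj : Set.InjOn g (Finset.range (T + 1)) := by
      have key : ∀ s t, s ≤ T → t ≤ T → s < t → g s ≠ g t := by
        intro s t hs ht hst he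
        exact (hg t ht).2 (he ▸ within_mono rule n base hst (hg s hs).1)
      intro s hs t ht he
      simp only [Finset.coe_range, Set.mem_Iio, Nat.lt_succ_iff] at hs ht
      rcases lt_trichotomy s t with h | h | h
      · exact absurd he (key s t hs ht h)
      · exact h
      · exact absurd he.symm (key t s ht hs h)
    have := Finset.card_le_card_of_injOn g hmaps hinj
    simp at this
    lia
  refine within_mono rule n base ht ?_
  induction hf with
  | base hf => exact within_mono rule n base (Nat.zero_le t) hf
  | step k ρ hρ _ ih => exact hst (.inr ⟨k, ρ, hρ, ih, rfl⟩)

namespace Cmd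

variable {R I : Type}

/-- Run a program for all values of some registers. -/
def loops (l : List I) (c : Cmd R I) : Cmd R I := l.foldr loop c

/-- Run some programs in succession. -/
def seqs (l : List (Cmd R I)) : Cmd R I := l.foldr seq skip

theorem nested_loops (l : List I) (hl : l.Nodup) (c : Cmd R I) (used : List I)
    (hu : ∀ i ∈ l, i ∉ used) (hc : ∀ used' : List I, (∀ j ∈ used', j ∈ l ∨ j ∈ used) →
      c.Nested used') : (loops l c).Nested used := by
  induction l generalizing used with
  | nil => exact hc used fun j hj => .inr hj
  | cons i l ih =>
    rw [List.nodup_cons] at hl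
    refine ⟨hu i List.mem_cons_self, ih hl.2 (i :: used) (fun j hj => ?_) fun used' h => hc used'
      fun j hj => ?_⟩
    · simp only [List.mem_cons, not_or]
      exact ⟨fun h => hl.1 (h ▸ hj), hu j (List.mem_cons_of_mem _ hj)⟩
    · have := h j hj
      simp only [List.mem_cons] at this ⊢
      tauto

theorem nested_seqs (l : List (Cmd R I)) (used : List I) (h : ∀ c ∈ l, c.Nested used) :
    (seqs l).Nested used := by
  induction l with
  | nil => trivial
  | cons c l ih =>
    exact ⟨h c List.mem_cons_self, ih fun d hd => h d (List.mem_cons_of_mem _ hd)⟩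

variable {V N : Type}

/-- Add the head of a rule if the body is in the database. -/
def ofRule (r : Rule R V) : Cmd R (V ⊕ V) :=
  r.body.foldr (fun a c => guard a.1 (a.2.map Sum.inl) c) (add r.head.1 (r.head.2.map Sum.inl))

theorem nested_ofRule (r : Rule R V) (used : List (V ⊕ V)) : (ofRule r).Nested used := by
  unfold ofRule
  induction r.body with
  | nil => trivial
  | cons a l ih => exact ih

/-- One round: try all rules, for all values of the variables. -/
noncomputable def round [Fintype V] [Fintype N] (rule : N → Rule R V) : Cmd R (V ⊕ V) :=
  loops (Finset.univ.toList.map Sum.inl) (seqs (Finset.univ.toList.map fun k => ofRule (rule k)))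

/-- As many rounds as there are instances of rules. The second copy of the variables is used to
count them. -/
noncomputable def ofRules [Fintype V] [Fintype N] (rule : N → Rule R V) : Cmd R (V ⊕ V) :=
  loops (Finset.univ.toList.map Sum.inr) (seqs (List.replicate (Fintype.card N) (round rule)))

theorem nested_ofRules [Fintype V] [Fintype N] (rule : N → Rule R V) :
    (ofRules rule).Nested [] := by
  refine nested_loops _ ((Finset.nodup_toList _).map Sum.inr_injective) _ _ (by simp) fun used h =>
    nested_seqs _ _ fun c hc => ?_
  rw [List.eq_of_mem_replicate hc]
  refine nested_loops _ ((Finset.nodup_toList _).map Sum.inl_injective) _ _ (fun i hi hu => ?_)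
    fun used' _ => nested_seqs _ _ fun c hc => ?_
  · have := h i hu
    simp at hi this
    obtain ⟨a, rfl⟩ := hi
    simp at this
  · obtain ⟨k, -, rfl⟩ := List.mem_map.1 hc
    exact nested_ofRule _ _

variable [DecidableEq R] [DecidableEq I]

theorem run_loops_invariant (n : ℕ) (c : Cmd R I) (P : List (Fact R) → Prop)
    (h : ∀ ρ : I → ℕ, (∀ i, ρ i ≤ n) → ∀ F, P F → P (c.run n ρ F)) (l : List I) :
    ∀ ρ : I → ℕ, (∀ i, ρ i ≤ n) → ∀ F, P F → P ((loops l c).run n ρ F) := by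
  induction l with
  | nil => exact h
  | cons i l ih =>
    intro ρ hρ F hF
    have key : ∀ (xs : List ℕ) (F : List (Fact R)), (∀ x ∈ xs, x ≤ n) → P F →
        P (xs.foldl (fun F x => (loops l c).run n (update ρ i x) F) F) := by
      intro xs
      induction xs with
      | nil => exact fun F _ hF => hF
      | cons x xs ihx =>
        intro F hx hF
        refine ihx _ (fun y hy => hx y (List.mem_cons_of_mem _ hy)) (ih _ (fun j => ?_) F hF)
        by_cases hj : j = i
        · subst hj; simpa using hx x List.mem_cons_self
        · simpa [hj] using hρ j
    exact key _ F (by simp) hF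

theorem run_seqs_invariant (n : ℕ) (l : List (Cmd R I)) (P : List (Fact R) → Prop) (ρ : I → ℕ)
    (h : ∀ c ∈ l, ∀ F, P F → P (c.run n ρ F)) (F : List (Fact R)) (hF : P F) :
    P ((seqs l).run n ρ F) := by
  induction l generalizing F with
  | nil => exact hF
  | cons c l ih =>
    exact ih (fun d hd => h d (List.mem_cons_of_mem _ hd)) _ (h c List.mem_cons_self F hF)

/-- Nested loops run their body, on some larger database, for all values of the registers. -/
theorem run_loops_hit (n : ℕ) (c : Cmd R I) (l : List I) (ρ τ : I → ℕ) (hτ : ∀ i ∈ l, τ i ≤ n)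
    (hρ : ∀ i ∉ l, τ i = ρ i) (F : List (Fact R)) :
    ∃ G, F <:+ G ∧ c.run n τ G <:+ (loops l c).run n ρ F := by
  induction l generalizing ρ F with
  | nil =>
    obtain rfl : τ = ρ := funext fun i => hρ i List.not_mem_nil
    exact ⟨F, List.suffix_rfl, List.suffix_rfl⟩
  | cons i l ih =>
    obtain ⟨xs, ys, h⟩ := List.append_of_mem
      (List.mem_range.2 (Nat.lt_succ_iff.2 (hτ i List.mem_cons_self)))
    set f := fun (F : List (Fact R)) (x : ℕ) => (loops l c).run n (update ρ i x) F with hf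
    have hsuf : ∀ (zs : List ℕ) (F : List (Fact R)), F <:+ zs.foldl f F := fun zs F =>
      foldl_invariant (fun G => F <:+ G) f (fun G x h => h.trans (suffix_run n _ _ G)) zs F
        List.suffix_rfl
    obtain ⟨G, hG, hr⟩ := ih (update ρ i (τ i)) (fun j hj => hτ j (List.mem_cons_of_mem _ hj))
      (fun j hj => by
        by_cases hji : j = i
        · subst hji; simp
        · simpa [hji] using hρ j (by simp [hji, hj])) (xs.foldl f F)
    refine ⟨G, (hsuf xs F).trans hG, hr.trans ?_⟩
    change _ <:+ (List.range (n + 1)).foldl f F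
    rw [h, List.foldl_append, List.foldl_cons]
    exact hsuf ys _

theorem run_seqs_hit (n : ℕ) (l : List (Cmd R I)) (c : Cmd R I) (hc : c ∈ l) (ρ : I → ℕ)
    (F : List (Fact R)) : ∃ G, F <:+ G ∧ c.run n ρ G <:+ (seqs l).run n ρ F := by
  induction l generalizing F with
  | nil => simp at hc
  | cons d l ih =>
    rcases List.mem_cons.1 hc with rfl | hc
    · exact ⟨F, List.suffix_rfl, suffix_run n (seqs l) ρ _⟩
    · obtain ⟨G, hG, hr⟩ := ih hc (d.run n ρ F)
      exact ⟨G, (suffix_run n d ρ F).trans hG, hr⟩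

/-- A program makes up for `j` rounds of derivations. -/
def Advances (rule : N → Rule R V) (n : ℕ) (base : Set (Fact R)) (c : Cmd R I) (j : ℕ) : Prop :=
  ∀ (ρ : I → ℕ) (F : List (Fact R)) (t : ℕ), (∀ f ∈ Within rule n base t, f ∈ F) →
    ∀ f ∈ Within rule n base (t + j), f ∈ c.run n ρ F

theorem Advances.seqs_replicate {rule : N → Rule R V} {n : ℕ} {base : Set (Fact R)} {c : Cmd R I}
    {j : ℕ} (h : Advances rule n base c j) (m : ℕ) :
    Advances rule n base (seqs (List.replicate m c)) (m * j) := by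
  induction m with
  | zero =>
    intro ρ F t hF f hf
    exact hF f (by simpa using hf)
  | succ m ih =>
    intro ρ F t hF f hf
    refine ih ρ _ (t + j) (h ρ F t hF) f ?_
    rwa [add_assoc, add_comm j, ← Nat.succ_mul]

theorem Advances.loops {rule : N → Rule R V} {n : ℕ} {base : Set (Fact R)} {c : Cmd R I}
    {j : ℕ} (h : Advances rule n base c j) (l : List I) :
    Advances rule n base (loops l c) ((n + 1) ^ l.length * j) := by
  induction l with
  | nil => simpa [Cmd.loops] using h
  | cons i l ih =>
    intro ρ F t hF f hf
    have key : ∀ (xs : List ℕ) (F : List (Fact R)) (t : ℕ),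
        (∀ f ∈ Within rule n base t, f ∈ F) →
        ∀ f ∈ Within rule n base (t + xs.length * ((n + 1) ^ l.length * j)),
          f ∈ xs.foldl (fun F x => (Cmd.loops l c).run n (update ρ i x) F) F := by
      intro xs
      induction xs with
      | nil => exact fun F t hF f hf => hF f (by simpa using hf)
      | cons x xs ihx =>
        intro F t hF f hf
        refine ihx _ (t + (n + 1) ^ l.length * j) (ih _ F t hF) f ?_
        rwa [add_assoc, add_comm ((n + 1) ^ l.length * j), ← Nat.succ_mul]
    refine key (List.range (n + 1)) F t hF f ?_
    rw [List.length_range, ← mul_assoc, ← pow_succ']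
    exact hf

variable [DecidableEq V]

theorem run_ofRule (n : ℕ) (r : Rule R V) (ρ : V ⊕ V → ℕ) (F : List (Fact R)) :
    (ofRule r).run n ρ F = if ∀ a ∈ r.body, inst (ρ ∘ Sum.inl) a ∈ F
      then inst (ρ ∘ Sum.inl) r.head :: F else F := by
  unfold ofRule
  induction r.body with
  | nil => simp [run, inst]
  | cons a l ih =>
    rw [List.foldr_cons, run, ih]
    simp only [List.map_map, List.mem_cons, forall_eq_or_imp, inst]
    by_cases h : (a.1, a.2.map (ρ ∘ Sum.inl)) ∈ F
    · rw [if_pos h]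
      exact if_congr (by simp [h]) rfl rfl
    · rw [if_neg h, if_neg fun h' => h h'.1]

variable [Fintype V] [Fintype N]

theorem derives_of_mem_run (rule : N → Rule R V) (n : ℕ) (base : Set (Fact R)) (F : List (Fact R))
    (hF : ∀ f ∈ F, Derives rule n base f) (f : Fact R)
    (hf : f ∈ (ofRules rule).run n (fun _ => 0) F) : Derives rule n base f := by
  refine run_loops_invariant n _ (fun G => ∀ f ∈ G, Derives rule n base f) (fun ρ hρ G hG =>
    run_seqs_invariant n _ (fun G => ∀ f ∈ G, Derives rule n base f) ρ (fun c hc G hG => ?_) G hG)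
    _ (fun _ => 0) (by simp) F hF f hf
  rw [List.eq_of_mem_replicate hc]
  refine run_loops_invariant n _ (fun G => ∀ f ∈ G, Derives rule n base f) (fun ρ hρ G hG =>
    run_seqs_invariant n _ (fun G => ∀ f ∈ G, Derives rule n base f) ρ (fun c hc G hG => ?_) G hG)
    _ ρ hρ G hG
  obtain ⟨k, -, rfl⟩ := List.mem_map.1 hc
  intro f hf
  rw [run_ofRule] at hf
  split_ifs at hf with h
  · rcases List.mem_cons.1 hf with rfl | hf
    · exact .step k _ (fun i => hρ _) fun a ha => hG _ (h a ha)
    · exact hG f hf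
  · exact hG f hf

theorem advances_round (rule : N → Rule R V) (n : ℕ) (base : Set (Fact R)) :
    Advances rule n base (round rule) 1 := by
  intro ρ F t hF f hf
  rcases hf with hf | ⟨k, τ, hτ, hbody, rfl⟩
  · exact (suffix_run n _ ρ F).mem (hF f hf)
  · obtain ⟨G, hG, hr⟩ := run_loops_hit n
      (seqs (Finset.univ.toList.map fun k => ofRule (rule k)))
      (Finset.univ.toList.map (Sum.inl : V → V ⊕ V)) ρ
      (Sum.elim τ (ρ ∘ Sum.inr)) (by simpa using hτ)
      (by simp) F
    obtain ⟨G', hG', hr'⟩ := run_seqs_hit n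
      (Finset.univ.toList.map fun k => ofRule (rule k)) (ofRule (rule k))
      (List.mem_map_of_mem (by simp)) (Sum.elim τ (ρ ∘ Sum.inr)) G
    refine hr.mem (hr'.mem ?_)
    rw [run_ofRule, if_pos]
    · simp
    · intro a ha
      exact hG'.mem (hG.mem (hF _ (by simpa using hbody a ha)))

theorem mem_run_of_derives (rule : N → Rule R V) (n : ℕ) (F : List (Fact R)) (f : Fact R)
    (hf : Derives rule n {f | f ∈ F} f) : f ∈ (ofRules rule).run n (fun _ => 0) F := by
  refine ((advances_round rule n {f | f ∈ F}).seqs_replicate (Fintype.card N)).loops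
    (Finset.univ.toList.map (Sum.inr : V → V ⊕ V)) (fun _ => 0) F 0 (fun f hf => hf) f ?_
  simpa using hf.within

end Cmd

/-- A property of words is decidable in polynomial time if its failure is derivable, by finitely
many Horn rules, from the facts that describe the word. -/
theorem polyTime_of_rules {A R V N : Type} [Fintype A] [Fintype R] [DecidableEq R] [Fintype V]
    [DecidableEq V] [Nonempty V] [Fintype N] (rule : N → Rule R V) (edge : A → R)
    (zero last fail : R) {α : Type} (ea : α → List A) (f : α → Bool)
    (hf : ∀ a, f a = true ↔ ¬ Derives rule (ea a).length
      {f | f ∈ wordFacts edge zero last (ea a)} (fail, [])) :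
    Nonempty (Turing.TM2ComputableInPolyTime ea Computability.encodeBool f) := by
  obtain ⟨v⟩ := ‹Nonempty V›
  refine polyTime_of_cmd (Cmd.ofRules rule) (Cmd.nested_ofRules rule) edge zero last fail
    (i₀ := Sum.inl v) (i₁ := Sum.inr v) (by simp) ea f fun a => ?_
  rw [hf a, not_iff_not]
  exact ⟨Cmd.mem_run_of_derives rule _ _ _,
    Cmd.derives_of_mem_run rule _ _ _ (fun f hf => .base hf) _⟩

end StackMachine

namespace BC

variable {C : Type}

/-! ### Lists of element terms -/

/-- The list that `bc` computes: the entries of `L` are chained, starting with `z`. -/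
def chain : List (Term C .elem) → Term C .elem → List (Term C .elem)
  | [], _ => []
  | x :: L, z => .h x z :: chain L (.h x z)

@[simp]
theorem length_chain (L : List (Term C .elem)) (z : Term C .elem) :
    (chain L z).length = L.length := by
  induction L generalizing z with
  | nil => rfl
  | cons x L ih => simp [chain, ih]

theorem chain_getElem?_zero (L : List (Term C .elem)) (z : Term C .elem) :
    (chain L z)[0]? = L[0]?.map fun x => .h x z := by
  cases L <;> rfl

theorem chain_getElem?_succ {L : List (Term C .elem)} {z x y : Term C .elem} {j : ℕ}
    (hx : L[j + 1]? = some x) (hy : (chain L z)[j]? = some y) :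
    (chain L z)[j + 1]? = some (.h x y) := by
  induction L generalizing z j with
  | nil => simp at hx
  | cons a L ih =>
    cases j with
    | zero =>
      simp only [chain, List.getElem?_cons_succ, List.getElem?_cons_zero, Option.some.injEq,
        zero_add] at hx hy ⊢
      rw [chain_getElem?_zero, hx, ← hy]
      rfl
    | succ j =>
      simp only [chain, List.getElem?_cons_succ] at hx hy ⊢
      exact ih hx hy

theorem exists_chain_head {L : List (Term C .elem)} {z : Term C .elem} (h : 0 < L.length) :
    ∃ a, L[0]? = some a ∧ (chain L z)[0]? = some (.h a z) := by
  rw [chain_getElem?_zero, List.getElem?_eq_getElem h]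
  exact ⟨_, rfl, rfl⟩

theorem exists_chain_tail {L : List (Term C .elem)} {z : Term C .elem} {j : ℕ}
    (h : j + 1 < L.length) : ∃ a c, L[j + 1]? = some a ∧ (chain L z)[j]? = some c ∧
      (chain L z)[j + 1]? = some (.h a c) := by
  have h1 := List.getElem?_eq_getElem h
  have h2 := List.getElem?_eq_getElem (l := chain L z) (i := j) (by simp; lia)
  exact ⟨_, _, h1, h2, chain_getElem?_succ h1 h2⟩

/-- The entries of a list term, if its list variables stand for the empty list. -/
def items : ∀ {s : Srt}, Term C s → List (Term C .elem)
  | _, .cons x Y => x :: items Y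
  | _, .bc X y => chain (items X) y
  | _, _ => []

/-- The term that writes down a list. -/
def ofList : List (Term C .elem) → Term C .list
  | [] => .nil
  | x :: L => .cons x (ofList L)

theorem EqBC0.bc_ofList (L : List (Term C .elem)) (z : Term C .elem) :
    EqBC0 (.bc (ofList L) z) (ofList (chain L z)) := by
  induction L generalizing z with
  | nil => exact .bc_nil z
  | cons x L ih => exact .trans (.bc_cons x z _) (.cons_congr (.refl _) (ih _))

/-- A term of sort `elem`, and a dummy for a term of sort `list`. -/
def elemPart : ∀ {s : Srt}, Term C s → Term C .elem
  | .elem, t => t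
  | .list, _ => .var 0

/-- The theory does not identify different element terms, and it respects the entries of lists. -/
theorem EqBC0.items_eq {s : Srt} {t u : Term C s} (h : EqBC0 t u) :
    items t = items u ∧ elemPart t = elemPart u := by
  induction h with
  | bc_nil z => exact ⟨rfl, rfl⟩
  | bc_cons x z Y => exact ⟨rfl, rfl⟩
  | refl t => exact ⟨rfl, rfl⟩
  | symm _ ih => exact ⟨ih.1.symm, ih.2.symm⟩
  | trans _ _ ih ih' => exact ⟨ih.1.trans ih'.1, ih.2.trans ih'.2⟩
  | h_congr _ _ ihx ihy => exact ⟨rfl, congrArg₂ Term.h ihx.2 ihy.2⟩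
  | cons_congr _ _ ihx ihy => exact ⟨congrArg₂ List.cons ihx.2 ihy.1, rfl⟩
  | bc_congr _ _ ihx ihy => exact ⟨congrArg₂ chain ihx.1 ihy.2, rfl⟩

theorem EqBC0.eq_of_elem {t u : Term C .elem} (h : EqBC0 t u) : t = u := h.items_eq.2

/-- An equation holds if its variables have the values `x` and `l`. -/
def StdEq.Holds (x : ℕ → Term C .elem) (l : ℕ → List (Term C .elem)) : StdEq C → Prop
  | .listVar U V => l U = l V
  | .bc U V y => l U = chain (l V) (x y)
  | .cons U v W => l U = x v :: l W
  | .nil U => l U = []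
  | .elemVar u v => x u = x v
  | .h v w y => x v = .h (x w) (x y)
  | .const u c => x u = .const c

/-- Unifiability is solvability over element terms and finite lists of element terms. -/
theorem unifiable_iff (P : Problem C) :
    Unifiable P ↔ ∃ (x : ℕ → Term C .elem) (l : ℕ → List (Term C .elem)), ∀ e ∈ P, e.Holds x l := by
  constructor
  · rintro ⟨σ, hσ⟩
    refine ⟨σ .elem, fun U => items (σ .list U), fun e he => ?_⟩
    have h := hσ e he
    cases e with
    | listVar | bc | cons | nil => exact h.items_eq.1
    | elemVar | h | const => exact h.eq_of_elem
  · rintro ⟨x, l, hxl⟩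
    refine ⟨fun s k => match s with
      | .elem => x k
      | .list => ofList (l k), fun e he => ?_⟩
    have h := hxl e he
    cases e with
    | listVar U V =>
      change EqBC0 (ofList (l U)) (ofList (l V))
      rw [show l U = _ from h]
      exact .refl _
    | bc U V y =>
      change EqBC0 (ofList (l U)) (.bc (ofList (l V)) (x y))
      rw [show l U = _ from h]
      exact (EqBC0.bc_ofList _ _).symm
    | cons U v W =>
      change EqBC0 (ofList (l U)) (.cons (x v) (ofList (l W)))
      rw [show l U = _ from h]
      exact .refl _
    | nil U =>
      change EqBC0 (ofList (l U)) .nil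
      rw [show l U = _ from h]
      exact .refl _
    | elemVar u v =>
      change EqBC0 (x u) (x v)
      rw [show x u = _ from h]
      exact .refl _
    | h v w y =>
      change EqBC0 (x v) (.h (x w) (x y))
      rw [show x v = _ from h]
      exact .refl _
    | const u c =>
      change EqBC0 (x u) (.const c)
      rw [show x u = _ from h]
      exact .refl _

/-! ### The alphabet -/

/-- The letters, as a sum type. -/
def letterEquiv : Letter ≃ Fin 7 ⊕ Bool ⊕ Unit where
  toFun
    | .tag k => .inl k
    | .bit b => .inr (.inl b)
    | .mark => .inr (.inr ())
  invFun
    | .inl k => .tag k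
    | .inr (.inl b) => .bit b
    | .inr (.inr ()) => .mark
  left_inv a := by cases a <;> rfl
  right_inv a := by rcases a with _ | _ | _ <;> rfl

instance : DecidableEq Letter := letterEquiv.decidableEq

instance : Fintype Letter := .ofEquiv _ letterEquiv.symm

/-! ### Positions in a word -/

/-- The letter at the position `p` is `a`, and `q` is the next position. -/
def Edge (w : List Letter) (a : Letter) (p q : ℕ) : Prop :=
  q = p + 1 ∧ w.drop p = a :: w.drop q

theorem edge_iff {w : List Letter} {a : Letter} {p q : ℕ} :
    Edge w a p q ↔ w[p]? = some a ∧ q = p + 1 := by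
  constructor
  · rintro ⟨rfl, h⟩
    refine ⟨?_, rfl⟩
    have := congrArg List.head? h
    simpa [List.head?_drop] using this
  · rintro ⟨h, rfl⟩
    obtain ⟨hp, rfl⟩ := List.getElem?_eq_some_iff.1 h
    exact ⟨rfl, List.drop_eq_getElem_cons hp⟩

theorem edge_of_drop {w s : List Letter} {a : Letter} {p : ℕ} (h : w.drop p = a :: s) :
    Edge w a p (p + 1) ∧ w.drop (p + 1) = s := by
  have hs : w.drop (p + 1) = s := by rw [← List.drop_drop, h]; rfl
  exact ⟨⟨rfl, by rw [h, hs]⟩, hs⟩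

theorem Edge.lt_length {w : List Letter} {a : Letter} {p q : ℕ} (h : Edge w a p q) :
    p < w.length := by
  by_contra! hp
  have := h.2
  rw [List.drop_eq_nil_of_le hp] at this
  simp at this

/-- The bits `b`, followed by a mark, lead from the position `p` to `q`. -/
def NameTo (w : List Letter) (b : List Bool) (p q : ℕ) : Prop :=
  w.drop p = b.map Letter.bit ++ Letter.mark :: w.drop q

/-- The bits `b`, followed by a mark, start at the position `p`. -/
def NameAt (w : List Letter) (b : List Bool) (p : ℕ) : Prop :=
  ∃ s, w.drop p = b.map Letter.bit ++ Letter.mark :: s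

theorem bits_append {b b' : List Bool} {s s' : List Letter}
    (h : b.map Letter.bit ++ Letter.mark :: s = b'.map Letter.bit ++ Letter.mark :: s') :
    b = b' ∧ s = s' := by
  induction b generalizing b' with
  | nil => cases b' <;> simp_all
  | cons x b ih =>
    cases b' with
    | nil => simp at h
    | cons y b' =>
      simp only [List.map_cons, List.cons_append, List.cons.injEq, Letter.bit.injEq] at h
      obtain ⟨rfl, rfl⟩ := ih h.2
      simp [h.1]

theorem NameAt.unique {w : List Letter} {b b' : List Bool} {p : ℕ} (h : NameAt w b p)
    (h' : NameAt w b' p) : b = b' := by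
  obtain ⟨s, hs⟩ := h
  obtain ⟨s', hs'⟩ := h'
  exact (bits_append (hs.symm.trans hs')).1

theorem nameAt_cons {w : List Letter} {x : Bool} {b : List Bool} {p q : ℕ}
    (h : Edge w (.bit x) p q) : NameAt w (x :: b) p ↔ NameAt w b q := by
  simp [NameAt, h.2]

theorem nameAt_nil {w : List Letter} {p q : ℕ} (h : Edge w .mark p q) : NameAt w [] p :=
  ⟨_, h.2⟩

/-- The letter at a tag of a written problem starts an equation. -/
theorem exists_eq_of_tag [Encodable C] {P : Problem C} {k : Fin 7} {p : ℕ} {s : List Letter}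
    (h : (writeProblem P).drop p = .tag k :: s) :
    ∃ e ∈ P, ∃ s', writeEq e ++ s' = .tag k :: s := by
  induction P generalizing p with
  | nil => simp [writeProblem] at h
  | cons e P ih =>
    -- the letters of an equation after the first one are no tags
    have hno : ∀ q, 0 < q → Letter.tag k ∉ (writeEq e)[q]? := by
      intro q hq
      obtain ⟨q, rfl⟩ := Nat.exists_eq_succ_of_ne_zero hq.ne'
      have hname : ∀ m, Letter.tag k ∉ writeName m := by simp [writeName]
      have htail : Letter.tag k ∉ (writeEq e).tail := by
        cases e <;> simp [writeEq, hname]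
      rw [Option.mem_def]
      intro hmem
      refine htail (List.mem_of_getElem? (i := q) ?_)
      simpa using hmem
    have hw : writeProblem (e :: P) = writeEq e ++ writeProblem P := rfl
    rw [hw] at h
    rcases Nat.eq_zero_or_pos p with rfl | hp
    · exact ⟨e, List.mem_cons_self, _, h⟩
    rcases lt_or_ge p (writeEq e).length with hlt | hge
    · exfalso
      refine hno p hp ?_
      have := congrArg List.head? h
      rw [List.head?_drop, List.getElem?_append_left hlt] at this
      simpa using this
    · rw [List.drop_append, List.drop_eq_nil_of_le hge, List.nil_append] at h
      obtain ⟨e', he', s', hs'⟩ := ih h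
      exact ⟨e', List.mem_cons_of_mem _ he', s', hs'⟩

theorem exists_drop_of_mem [Encodable C] {P : Problem C} {e : StdEq C} (he : e ∈ P) :
    ∃ p s, (writeProblem P).drop p = writeEq e ++ s := by
  obtain ⟨P₁, P₂, rfl⟩ := List.append_of_mem he
  refine ⟨(writeProblem P₁).length, writeProblem P₂, ?_⟩
  simp [writeProblem]

theorem two_mul_length_le [Encodable C] (P : Problem C) :
    2 * P.length ≤ (writeProblem P).length := by
  induction P with
  | nil => simp
  | cons e P ih =>
    have : 2 ≤ (writeEq e).length := by
      cases e <;> simp [writeEq, writeName] <;> lia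
    simp only [writeProblem, List.flatMap_cons, List.length_append, List.length_cons] at ih ⊢
    lia

end BC

namespace BC

open StackMachine

variable {C : Type}

/-! ### The rules -/

/-- The relations between the positions in a written problem. Besides the position `p` of a name,
the arguments of most of them contain an index `i`. The pair `p, i` is a node: it stands for the
value of the element variable at `p` if `i = 0`, and otherwise for the entry number `i`, counted
from `1`, of the value of the list variable at `p`. -/
inductive Rel
  /-- `edge a [p, q]`: the letter at `p` is `a`, and `q` is the next position. -/
  | edge (a : Letter)
  /-- `zero [p]`: `p` is the first position. -/
  | zero
  /-- `last [p]`: `p` is the last position, behind all letters. -/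
  | last
  /-- `succ [p, q]`: `q` is the next position after `p`. -/
  | succ
  /-- `name [p, q]`: the name at `p` ends just before `q`. -/
  | name
  /-- `same [p, q]`: there are equal names at `p` and `q`. -/
  | same
  /-- `diff [p, q]`: there are different names at `p` and `q`. -/
  | diff
  /-- `eqn k ps`: an equation with tag `k` contains successive names at the positions `ps`. -/
  | eqn (k : Fin 7)
  /-- `entry [p, i]`: the list variable at `p` has an entry number `i`. -/
  | entry
  /-- `eq [p, i, q, j]`: two nodes have the same value. -/
  | eq
  /-- `child b [p, i, q, j]`: the value of the node `p, i` is a term `h` whose left (`b = false`) or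
  right (`b = true`) argument is the value of the node `q, j`. -/
  | child (b : Bool)
  /-- `const [p, i, q]`: the value of the node `p, i` is the constant whose name is at `q`. -/
  | const
  /-- `sub [p, i, q, j]`: the value of `q, j` is a proper subterm of the value of `p, i`. -/
  | sub
  /-- `fail []`: the problem is not unifiable. -/
  | fail
  deriving DecidableEq, Fintype

/-- The names of the Horn rules. -/
inductive RuleName
  | succ (a : Letter)
  | nameEnd | nameBit (b : Bool)
  | sameEnd | sameBit (b : Bool)
  | diffEnd (b : Bool) | diffEnd' (b : Bool) | diffBit (b : Bool) | diffTail (b : Bool)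
  | eqn₁ (k : Fin 7) | eqn₂ (k : Fin 7) | eqn₃ (k : Fin 7)
  | sameEq | sameEntry | sameEntryEq
  | listVarEntry | listVarEntry' | listVarEq
  | bcEntry | bcEntry' | bcHeadLeft | bcHeadRight | bcTailLeft | bcTailRight
  | consEntry | consEq | consTailEntry | consTailEntry' | consTailEq
  | entryDown | nilFail | lastFail
  | elemVar | hLeft | hRight | const
  | eqSymm | eqTrans | childRefl (b : Bool) | constRefl | childEq (b : Bool)
  | constConst | constChild (b : Bool)
  | childSub (b : Bool) | eqSub | subTrans | subFail
  deriving Fintype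

/-- The Horn rules. They compute the closure of the equations under unification: equality is
propagated from terms `h` to their arguments, and there must be no clash between constants or
between a constant and a term `h`, and no term that is its own proper subterm. For lists, the
entries are unified that must exist, since they are forced by an equation `U = cons(v, W)`. -/
def rule : RuleName → Rule Rel (Fin 8)
  | .succ a => ⟨[(.edge a, [0, 1])], (.succ, [0, 1])⟩
  | .nameEnd => ⟨[(.edge .mark, [0, 1])], (.name, [0, 1])⟩
  | .nameBit b => ⟨[(.edge (.bit b), [0, 1]), (.name, [1, 2])], (.name, [0, 2])⟩
  | .sameEnd => ⟨[(.edge .mark, [0, 1]), (.edge .mark, [2, 3])], (.same, [0, 2])⟩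
  | .sameBit b =>
    ⟨[(.edge (.bit b), [0, 1]), (.edge (.bit b), [2, 3]), (.same, [1, 3])], (.same, [0, 2])⟩
  | .diffEnd b => ⟨[(.edge (.bit b), [0, 1]), (.edge .mark, [2, 3])], (.diff, [0, 2])⟩
  | .diffEnd' b => ⟨[(.edge (.bit b), [0, 1]), (.edge .mark, [2, 3])], (.diff, [2, 0])⟩
  | .diffBit b => ⟨[(.edge (.bit b), [0, 1]), (.edge (.bit !b), [2, 3])], (.diff, [0, 2])⟩
  | .diffTail b =>
    ⟨[(.edge (.bit b), [0, 1]), (.edge (.bit b), [2, 3]), (.diff, [1, 3])], (.diff, [0, 2])⟩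
  | .eqn₁ k => ⟨[(.edge (.tag k), [0, 1])], (.eqn k, [1])⟩
  | .eqn₂ k => ⟨[(.edge (.tag k), [0, 1]), (.name, [1, 2])], (.eqn k, [1, 2])⟩
  | .eqn₃ k =>
    ⟨[(.edge (.tag k), [0, 1]), (.name, [1, 2]), (.name, [2, 3])], (.eqn k, [1, 2, 3])⟩
  | .sameEq => ⟨[(.same, [0, 1]), (.zero, [2])], (.eq, [0, 2, 1, 2])⟩
  | .sameEntry => ⟨[(.same, [0, 1]), (.entry, [0, 2])], (.entry, [1, 2])⟩
  | .sameEntryEq => ⟨[(.same, [0, 1]), (.entry, [0, 2])], (.eq, [0, 2, 1, 2])⟩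
  | .listVarEntry => ⟨[(.eqn 0, [0, 1]), (.entry, [0, 2])], (.entry, [1, 2])⟩
  | .listVarEntry' => ⟨[(.eqn 0, [0, 1]), (.entry, [1, 2])], (.entry, [0, 2])⟩
  | .listVarEq => ⟨[(.eqn 0, [0, 1]), (.entry, [0, 2])], (.eq, [0, 2, 1, 2])⟩
  | .bcEntry => ⟨[(.eqn 1, [0, 1, 2]), (.entry, [0, 3])], (.entry, [1, 3])⟩
  | .bcEntry' => ⟨[(.eqn 1, [0, 1, 2]), (.entry, [1, 3])], (.entry, [0, 3])⟩
  | .bcHeadLeft =>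
    ⟨[(.eqn 1, [0, 1, 2]), (.zero, [3]), (.succ, [3, 4]), (.entry, [0, 4])],
      (.child false, [0, 4, 1, 4])⟩
  | .bcHeadRight =>
    ⟨[(.eqn 1, [0, 1, 2]), (.zero, [3]), (.succ, [3, 4]), (.entry, [0, 4])],
      (.child true, [0, 4, 2, 3])⟩
  | .bcTailLeft =>
    ⟨[(.eqn 1, [0, 1, 2]), (.entry, [0, 3]), (.succ, [3, 4]), (.entry, [0, 4])],
      (.child false, [0, 4, 1, 4])⟩
  | .bcTailRight =>
    ⟨[(.eqn 1, [0, 1, 2]), (.entry, [0, 3]), (.succ, [3, 4]), (.entry, [0, 4])],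
      (.child true, [0, 4, 0, 3])⟩
  | .consEntry => ⟨[(.eqn 2, [0, 1, 2]), (.zero, [3]), (.succ, [3, 4])], (.entry, [0, 4])⟩
  | .consEq => ⟨[(.eqn 2, [0, 1, 2]), (.zero, [3]), (.succ, [3, 4])], (.eq, [0, 4, 1, 3])⟩
  | .consTailEntry => ⟨[(.eqn 2, [0, 1, 2]), (.entry, [2, 3]), (.succ, [3, 4])], (.entry, [0, 4])⟩
  | .consTailEntry' =>
    ⟨[(.eqn 2, [0, 1, 2]), (.entry, [0, 5]), (.succ, [4, 5]), (.succ, [3, 4])], (.entry, [2, 4])⟩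
  | .consTailEq =>
    ⟨[(.eqn 2, [0, 1, 2]), (.entry, [2, 3]), (.succ, [3, 4])], (.eq, [0, 4, 2, 3])⟩
  | .entryDown => ⟨[(.entry, [0, 3]), (.succ, [2, 3]), (.succ, [1, 2])], (.entry, [0, 2])⟩
  | .nilFail => ⟨[(.eqn 3, [0]), (.entry, [0, 1])], (.fail, [])⟩
  | .lastFail => ⟨[(.entry, [0, 1]), (.last, [1])], (.fail, [])⟩
  | .elemVar => ⟨[(.eqn 4, [0, 1]), (.zero, [2])], (.eq, [0, 2, 1, 2])⟩
  | .hLeft => ⟨[(.eqn 5, [0, 1, 2]), (.zero, [3])], (.child false, [0, 3, 1, 3])⟩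
  | .hRight => ⟨[(.eqn 5, [0, 1, 2]), (.zero, [3])], (.child true, [0, 3, 2, 3])⟩
  | .const => ⟨[(.eqn 6, [0, 1]), (.zero, [2])], (.const, [0, 2, 1])⟩
  | .eqSymm => ⟨[(.eq, [0, 1, 2, 3])], (.eq, [2, 3, 0, 1])⟩
  | .eqTrans => ⟨[(.eq, [0, 1, 2, 3]), (.eq, [2, 3, 4, 5])], (.eq, [0, 1, 4, 5])⟩
  | .childRefl b => ⟨[(.child b, [0, 1, 2, 3])], (.eq, [0, 1, 0, 1])⟩
  | .constRefl => ⟨[(.const, [0, 1, 2])], (.eq, [0, 1, 0, 1])⟩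
  | .childEq b =>
    ⟨[(.child b, [0, 1, 2, 3]), (.child b, [4, 5, 6, 7]), (.eq, [0, 1, 4, 5])], (.eq, [2, 3, 6, 7])⟩
  | .constConst =>
    ⟨[(.const, [0, 1, 2]), (.const, [3, 4, 5]), (.eq, [0, 1, 3, 4]), (.diff, [2, 5])], (.fail, [])⟩
  | .constChild b =>
    ⟨[(.const, [0, 1, 2]), (.child b, [3, 4, 5, 6]), (.eq, [0, 1, 3, 4])], (.fail, [])⟩
  | .childSub b => ⟨[(.child b, [0, 1, 2, 3])], (.sub, [0, 1, 2, 3])⟩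
  | .eqSub => ⟨[(.eq, [0, 1, 2, 3]), (.sub, [2, 3, 4, 5])], (.sub, [0, 1, 4, 5])⟩
  | .subTrans => ⟨[(.sub, [0, 1, 2, 3]), (.sub, [2, 3, 4, 5])], (.sub, [0, 1, 4, 5])⟩
  | .subFail => ⟨[(.sub, [0, 1, 0, 1])], (.fail, [])⟩

/-- What the rules derive from a word. -/
def Derivable (w : List Letter) (f : Fact Rel) : Prop :=
  Derives rule w.length {f | f ∈ wordFacts Rel.edge .zero .last w} f

theorem mem_wordFacts_iff {w : List Letter} {f : Fact Rel} :
    f ∈ wordFacts Rel.edge .zero .last w ↔ f = (.last, [w.length]) ∨ f = (.zero, [0]) ∨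
      ∃ a p q, Edge w a p q ∧ f = (.edge a, [p, q]) := by
  simp only [wordFacts, List.mem_cons, mem_readFacts, List.not_mem_nil, or_false, edge_iff,
    zero_add]
  refine or_congr_right (or_congr_right ⟨?_, ?_⟩)
  · rintro ⟨k, a, hk, rfl⟩
    exact ⟨a, k, k + 1, ⟨hk, rfl⟩, rfl⟩
  · rintro ⟨a, p, q, ⟨hp, rfl⟩, rfl⟩
    exact ⟨p, a, hp, rfl⟩

/-! ### Soundness of the rules -/

/-- The number of function symbols `h` in an element term. -/
def weight : ∀ {s : Srt}, Term C s → ℕ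
  | _, .h x y => weight x + weight y + 1
  | _, _ => 0

section Soundness

open Computability

variable (P : Problem C) (x : ℕ → Term C .elem) (l : ℕ → List (Term C .elem))

/-- The value of a node, where the variable has the name `b`. -/
def value (b : List Bool) : ℕ → Option (Term C .elem)
  | 0 => some (x (decodeNat b))
  | i + 1 => (l (decodeNat b))[i]?

/-- The entry number `j` of the list `l k` exists for all solutions: its existence is forced by
equations `U = cons(v, W)`, and as many as `j` of them are needed, since the list variables `W` in
them have different lengths. -/
def Forced (k j : ℕ) : Prop :=
  1 ≤ j ∧ j ≤ (l k).length ∧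
    ∀ i < j, ∃ U v W, .cons U v W ∈ P ∧ (l W).length + i + 1 = (l k).length

/-- The argument of a term `h`. -/
def IsChild (b : Bool) (t t' : Term C .elem) : Prop :=
  ∃ y z, t = .h y z ∧ t' = if b then z else y

variable {P x l}

theorem Forced.congr {k k' j : ℕ} (h : (l k).length = (l k').length) (hk : Forced P l k j) :
    Forced P l k' j := by
  unfold Forced at *
  rwa [← h]

theorem IsChild.eq {b : Bool} {t t' t'' : Term C .elem} (h : IsChild b t t')
    (h' : IsChild b t t'') : t' = t'' := by
  obtain ⟨y, z, rfl, rfl⟩ := h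
  obtain ⟨y', z', h1, rfl⟩ := h'
  cases h1
  rfl

theorem IsChild.weight_lt {b : Bool} {t t' : Term C .elem} (h : IsChild b t t') :
    weight t' < weight t := by
  obtain ⟨y, z, rfl, rfl⟩ := h
  cases b <;> simp [weight]

theorem exists_value_of_forced {b : List Bool} {i : ℕ} (h : Forced P l (decodeNat b) i) :
    ∃ t, value x l b i = some t ∧ ∃ i', i = i' + 1 ∧ (l (decodeNat b))[i']? = some t := by
  obtain ⟨i, rfl⟩ := Nat.exists_eq_succ_of_ne_zero (Nat.one_le_iff_ne_zero.1 h.1)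
  have hi : i < (l (decodeNat b)).length := h.2.1
  have := List.getElem?_eq_getElem hi
  exact ⟨_, this, i, rfl, this⟩

variable [Encodable C]

variable (P x l) in
/-- The meaning of the relations for a solution of the problem. -/
def Meaning : Fact Rel → Prop
  | (.edge a, [p, q]) => Edge (writeProblem P) a p q
  | (.zero, [p]) => p = 0
  | (.last, [p]) => p = (writeProblem P).length
  | (.succ, [p, q]) => q = p + 1
  | (.name, [p, q]) => ∃ b, NameTo (writeProblem P) b p q
  | (.same, [p, q]) => ∃ b, NameAt (writeProblem P) b p ∧ NameAt (writeProblem P) b q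
  | (.diff, [p, q]) => ∀ b b', NameAt (writeProblem P) b p → NameAt (writeProblem P) b' q → b ≠ b'
  | (.eqn k, [p]) => ∃ t, Edge (writeProblem P) (.tag k) t p
  | (.eqn k, [p, q]) => ∃ t b, Edge (writeProblem P) (.tag k) t p ∧ NameTo (writeProblem P) b p q
  | (.eqn k, [p, q, r]) => ∃ t b b', Edge (writeProblem P) (.tag k) t p ∧
      NameTo (writeProblem P) b p q ∧ NameTo (writeProblem P) b' q r
  | (.entry, [p, i]) => ∃ b, NameAt (writeProblem P) b p ∧ Forced P l (decodeNat b) i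
  | (.eq, [p, i, q, j]) => ∃ b b', NameAt (writeProblem P) b p ∧ NameAt (writeProblem P) b' q ∧
      value x l b i = value x l b' j
  | (.child c, [p, i, q, j]) => ∃ b b' t t', NameAt (writeProblem P) b p ∧
      NameAt (writeProblem P) b' q ∧ value x l b i = some t ∧ value x l b' j = some t' ∧
      IsChild c t t'
  | (.const, [p, i, q]) => ∃ b c, NameAt (writeProblem P) b p ∧
      NameAt (writeProblem P) (encodeNat (Encodable.encode c)) q ∧ value x l b i = some (.const c)
  | (.sub, [p, i, q, j]) => ∃ b b' t t', NameAt (writeProblem P) b p ∧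
      NameAt (writeProblem P) b' q ∧ value x l b i = some t ∧ value x l b' j = some t' ∧
      weight t' < weight t
  | _ => False

theorem NameTo.nameAt {w : List Letter} {b : List Bool} {p q : ℕ} (h : NameTo w b p q) :
    NameAt w b p := ⟨_, h⟩

theorem exists_listVar {t p q : ℕ} {b : List Bool} (ht : Edge (writeProblem P) (.tag 0) t p)
    (hb : NameTo (writeProblem P) b p q) :
    ∃ U V, .listVar U V ∈ P ∧ b = encodeNat U ∧ NameAt (writeProblem P) (encodeNat V) q := by
  obtain ⟨e, he, s, h⟩ := exists_eq_of_tag ht.2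
  cases e <;> simp [writeEq, writeName] at h
  case listVar U V =>
    obtain ⟨h1, h2⟩ := bits_append (h.trans hb)
    exact ⟨U, V, he, h1.symm, _, h2.symm⟩

theorem exists_bc {t p q r : ℕ} {b b' : List Bool} (ht : Edge (writeProblem P) (.tag 1) t p)
    (hb : NameTo (writeProblem P) b p q) (hb' : NameTo (writeProblem P) b' q r) :
    ∃ U V y, .bc U V y ∈ P ∧ b = encodeNat U ∧ b' = encodeNat V ∧
      NameAt (writeProblem P) (encodeNat y) r := by
  obtain ⟨e, he, s, h⟩ := exists_eq_of_tag ht.2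
  cases e <;> simp [writeEq, writeName] at h
  case bc U V y =>
    obtain ⟨h1, h2⟩ := bits_append (h.trans hb)
    obtain ⟨h3, h4⟩ := bits_append (h2.trans hb')
    exact ⟨U, V, y, he, h1.symm, h3.symm, _, h4.symm⟩

theorem exists_cons {t p q r : ℕ} {b b' : List Bool} (ht : Edge (writeProblem P) (.tag 2) t p)
    (hb : NameTo (writeProblem P) b p q) (hb' : NameTo (writeProblem P) b' q r) :
    ∃ U v W, .cons U v W ∈ P ∧ b = encodeNat U ∧ b' = encodeNat v ∧
      NameAt (writeProblem P) (encodeNat W) r := by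
  obtain ⟨e, he, s, h⟩ := exists_eq_of_tag ht.2
  cases e <;> simp [writeEq, writeName] at h
  case cons U v W =>
    obtain ⟨h1, h2⟩ := bits_append (h.trans hb)
    obtain ⟨h3, h4⟩ := bits_append (h2.trans hb')
    exact ⟨U, v, W, he, h1.symm, h3.symm, _, h4.symm⟩

theorem exists_nil {t p : ℕ} (ht : Edge (writeProblem P) (.tag 3) t p) :
    ∃ U, .nil U ∈ P ∧ NameAt (writeProblem P) (encodeNat U) p := by
  obtain ⟨e, he, s, h⟩ := exists_eq_of_tag ht.2
  cases e <;> simp [writeEq, writeName] at h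
  case nil U => exact ⟨U, he, _, h.symm⟩

theorem exists_elemVar {t p q : ℕ} {b : List Bool} (ht : Edge (writeProblem P) (.tag 4) t p)
    (hb : NameTo (writeProblem P) b p q) :
    ∃ u v, .elemVar u v ∈ P ∧ b = encodeNat u ∧ NameAt (writeProblem P) (encodeNat v) q := by
  obtain ⟨e, he, s, h⟩ := exists_eq_of_tag ht.2
  cases e <;> simp [writeEq, writeName] at h
  case elemVar U V =>
    obtain ⟨h1, h2⟩ := bits_append (h.trans hb)
    exact ⟨U, V, he, h1.symm, _, h2.symm⟩

theorem exists_h {t p q r : ℕ} {b b' : List Bool} (ht : Edge (writeProblem P) (.tag 5) t p)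
    (hb : NameTo (writeProblem P) b p q) (hb' : NameTo (writeProblem P) b' q r) :
    ∃ v u y, .h v u y ∈ P ∧ b = encodeNat v ∧ b' = encodeNat u ∧
      NameAt (writeProblem P) (encodeNat y) r := by
  obtain ⟨e, he, s, h⟩ := exists_eq_of_tag ht.2
  cases e <;> simp [writeEq, writeName] at h
  case h v u y =>
    obtain ⟨h1, h2⟩ := bits_append (h.trans hb)
    obtain ⟨h3, h4⟩ := bits_append (h2.trans hb')
    exact ⟨v, u, y, he, h1.symm, h3.symm, _, h4.symm⟩

theorem exists_const {t p q : ℕ} {b : List Bool} (ht : Edge (writeProblem P) (.tag 6) t p)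
    (hb : NameTo (writeProblem P) b p q) :
    ∃ u c, .const u c ∈ P ∧ b = encodeNat u ∧
      NameAt (writeProblem P) (encodeNat (Encodable.encode c)) q := by
  obtain ⟨e, he, s, h⟩ := exists_eq_of_tag ht.2
  cases e <;> simp [writeEq, writeName] at h
  case const u c =>
    obtain ⟨h1, h2⟩ := bits_append (h.trans hb)
    exact ⟨u, c, he, h1.symm, _, h2.symm⟩

/-- A forced entry has a number that is less than the length of the written problem. -/
theorem Forced.lt {k j : ℕ} (h : Forced P l k j) : j < (writeProblem P).length := by
  classical
  obtain ⟨h1, -, h2⟩ := h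
  -- the lengths of the tails in equations `U = cons(v, W)`
  set tail : StdEq C → ℕ := fun e => match e with
    | .cons _ _ W => (l W).length
    | _ => 0 with htail
  have hsub : (Finset.range j).image (fun i => (l k).length - i - 1) ⊆ (P.map tail).toFinset := by
    intro m hm
    obtain ⟨i, hi, rfl⟩ := Finset.mem_image.1 hm
    obtain ⟨U, v, W, hmem, hlen⟩ := h2 i (Finset.mem_range.1 hi)
    rw [List.mem_toFinset, List.mem_map]
    exact ⟨_, hmem, by simp only [htail]; lia⟩
  have hcard : ((Finset.range j).image fun i => (l k).length - i - 1).card = j := by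
    rw [Finset.card_image_of_injOn, Finset.card_range]
    intro i hi i' hi' he
    obtain ⟨_, _, _, -, hlen⟩ := h2 i (by simpa using hi)
    obtain ⟨_, _, _, -, hlen'⟩ := h2 i' (by simpa using hi')
    simp only at he
    lia
  have h3 := (Finset.card_le_card hsub).trans (List.toFinset_card_le _)
  rw [hcard, List.length_map] at h3
  have h4 := two_mul_length_le P
  lia

/-- The rules are sound: they derive only what holds for all solutions. -/
theorem meaning_of_derivable (hsol : ∀ e ∈ P, e.Holds x l) {f : Fact Rel}
    (hf : Derivable (writeProblem P) f) : Meaning P x l f := by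
  induction hf with
  | base hf =>
    rcases mem_wordFacts_iff.1 hf with rfl | rfl | ⟨a, p, q, h, rfl⟩
    · rfl
    · rfl
    · exact h
  | step k ρ hρ _ ih =>
    cases k <;> simp only [rule, inst, List.mem_cons, forall_eq_or_imp, List.map_cons, List.map_nil,
      List.not_mem_nil, false_imp_iff, implies_true, and_true, Meaning] at ih ⊢
    case succ => exact ih.1
    case nameEnd => exact ⟨[], ih.2⟩
    case nameBit =>
      obtain ⟨h1, b, h2⟩ := ih
      exact ⟨_ :: b, by rw [NameTo, h1.2, h2]; rfl⟩
    case sameEnd => exact ⟨[], nameAt_nil ih.1, nameAt_nil ih.2⟩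
    case sameBit =>
      obtain ⟨h1, h2, b, h3, h4⟩ := ih
      exact ⟨_ :: b, (nameAt_cons h1).2 h3, (nameAt_cons h2).2 h4⟩
    case diffEnd =>
      rintro b b' ⟨s, h1⟩ h2 rfl
      cases h2.unique (nameAt_nil ih.2)
      rw [ih.1.2] at h1
      simp at h1
    case diffEnd' =>
      rintro b b' h2 ⟨s, h1⟩ rfl
      cases h2.unique (nameAt_nil ih.2)
      rw [ih.1.2] at h1
      simp at h1
    case diffBit =>
      rintro b b' ⟨s, h1⟩ ⟨s', h2⟩ rfl
      rw [ih.1.2] at h1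
      rw [ih.2.2] at h2
      cases b <;> simp_all
    case diffTail =>
      rintro b b' ⟨s, h1⟩ ⟨s', h2⟩ rfl
      rw [ih.1.2] at h1
      rw [ih.2.1.2] at h2
      cases b with
      | nil => simp at h1
      | cons y b =>
        simp only [List.map_cons, List.cons_append, List.cons.injEq] at h1 h2
        exact ih.2.2 b b ⟨s, h1.2⟩ ⟨s', h2.2⟩ rfl
    case eqn₁ => exact ⟨_, ih⟩
    case eqn₂ => exact ⟨_, _, ih.1, ih.2.choose_spec⟩
    case eqn₃ => exact ⟨_, _, _, ih.1, ih.2.1.choose_spec, ih.2.2.choose_spec⟩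
    case sameEq =>
      obtain ⟨⟨b, h1, h2⟩, -⟩ := ih
      exact ⟨b, b, h1, h2, rfl⟩
    case sameEntry =>
      obtain ⟨⟨b, h1, h2⟩, b', h3, h4⟩ := ih
      cases h1.unique h3
      exact ⟨b, h2, h4⟩
    case sameEntryEq =>
      obtain ⟨⟨b, h1, h2⟩, -⟩ := ih
      exact ⟨b, b, h1, h2, rfl⟩
    case listVarEntry =>
      obtain ⟨⟨t, b, h1, h2⟩, b', h3, h4⟩ := ih
      obtain ⟨U, V, he, rfl, hV⟩ := exists_listVar h1 h2
      cases h3.unique h2.nameAt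
      rw [decode_encodeNat] at h4
      have : l U = l V := hsol _ he
      exact ⟨_, hV, by rw [decode_encodeNat]; exact h4.congr (by rw [this])⟩
    case listVarEntry' =>
      obtain ⟨⟨t, b, h1, h2⟩, b', h3, h4⟩ := ih
      obtain ⟨U, V, he, rfl, hV⟩ := exists_listVar h1 h2
      cases h3.unique hV
      rw [decode_encodeNat] at h4
      have : l U = l V := hsol _ he
      exact ⟨_, h2.nameAt, by rw [decode_encodeNat]; exact h4.congr (by rw [this])⟩
    case listVarEq =>
      obtain ⟨⟨t, b, h1, h2⟩, b', h3, h4⟩ := ih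
      obtain ⟨U, V, he, rfl, hV⟩ := exists_listVar h1 h2
      have : l U = l V := hsol _ he
      refine ⟨_, _, h2.nameAt, hV, ?_⟩
      cases h3.unique h2.nameAt
      obtain ⟨_, -, i, hi, -⟩ := exists_value_of_forced (x := x) h4
      simp [hi, value, this]
    case bcEntry =>
      obtain ⟨⟨t, b, b', h1, h2, h2'⟩, b'', h3, h4⟩ := ih
      obtain ⟨U, V, y, he, rfl, rfl, hy⟩ := exists_bc h1 h2 h2'
      cases h3.unique h2.nameAt
      rw [decode_encodeNat] at h4
      have : l U = chain (l V) (x y) := hsol _ he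
      exact ⟨_, h2'.nameAt, by rw [decode_encodeNat]; exact h4.congr (by simp [this])⟩
    case bcEntry' =>
      obtain ⟨⟨t, b, b', h1, h2, h2'⟩, b'', h3, h4⟩ := ih
      obtain ⟨U, V, y, he, rfl, rfl, hy⟩ := exists_bc h1 h2 h2'
      cases h3.unique h2'.nameAt
      rw [decode_encodeNat] at h4
      have : l U = chain (l V) (x y) := hsol _ he
      exact ⟨_, h2.nameAt, by rw [decode_encodeNat]; exact h4.congr (by simp [this])⟩
    case bcHeadLeft =>
      obtain ⟨⟨t, b, b', h1, h2, h2'⟩, h0, h01, b'', h3, h4⟩ := ih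
      obtain ⟨U, V, y, he, rfl, rfl, hy⟩ := exists_bc h1 h2 h2'
      cases h3.unique h2.nameAt
      rw [decode_encodeNat] at h4
      have : l U = chain (l V) (x y) := hsol _ he
      obtain ⟨a, ha, hU⟩ := exists_chain_head (L := l V) (z := x y)
        (by have h5 := h4.1.trans h4.2.1; rwa [this, length_chain] at h5)
      exact ⟨_, _, .h a (x y), a, h2.nameAt, h2'.nameAt, by simp [h01, h0, value, this, hU],
        by simp [h01, h0, value, ha], a, x y, rfl, rfl⟩
    case bcHeadRight =>
      obtain ⟨⟨t, b, b', h1, h2, h2'⟩, h0, h01, b'', h3, h4⟩ := ih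
      obtain ⟨U, V, y, he, rfl, rfl, hy⟩ := exists_bc h1 h2 h2'
      cases h3.unique h2.nameAt
      rw [decode_encodeNat] at h4
      have : l U = chain (l V) (x y) := hsol _ he
      obtain ⟨a, ha, hU⟩ := exists_chain_head (L := l V) (z := x y)
        (by have h5 := h4.1.trans h4.2.1; rwa [this, length_chain] at h5)
      exact ⟨_, _, .h a (x y), x y, h2.nameAt, hy, by simp [h01, h0, value, this, hU],
        by simp [h0, value], a, x y, rfl, rfl⟩
    case bcTailLeft =>
      obtain ⟨⟨t, b, b', h1, h2, h2'⟩, ⟨b₁, hb₁, hf₁⟩, hs, b'', h3, h4⟩ := ih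
      obtain ⟨U, V, y, he, rfl, rfl, hy⟩ := exists_bc h1 h2 h2'
      cases h3.unique h2.nameAt
      cases hb₁.unique h2.nameAt
      rw [decode_encodeNat] at h4 hf₁
      have : l U = chain (l V) (x y) := hsol _ he
      obtain ⟨i, hi⟩ := Nat.exists_eq_succ_of_ne_zero (Nat.one_le_iff_ne_zero.1 hf₁.1)
      obtain ⟨a, c, ha, hc, hU⟩ := exists_chain_tail (L := l V) (z := x y) (j := i)
        (by have := h4.2.1; simp_all)
      exact ⟨_, _, .h a c, a, h2.nameAt, h2'.nameAt, by simp [hs, hi, value, this, hU],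
        by simp [hs, hi, value, ha], a, c, rfl, rfl⟩
    case bcTailRight =>
      obtain ⟨⟨t, b, b', h1, h2, h2'⟩, ⟨b₁, hb₁, hf₁⟩, hs, b'', h3, h4⟩ := ih
      obtain ⟨U, V, y, he, rfl, rfl, hy⟩ := exists_bc h1 h2 h2'
      cases h3.unique h2.nameAt
      cases hb₁.unique h2.nameAt
      rw [decode_encodeNat] at h4 hf₁
      have : l U = chain (l V) (x y) := hsol _ he
      obtain ⟨i, hi⟩ := Nat.exists_eq_succ_of_ne_zero (Nat.one_le_iff_ne_zero.1 hf₁.1)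
      obtain ⟨a, c, ha, hc, hU⟩ := exists_chain_tail (L := l V) (z := x y) (j := i)
        (by have := h4.2.1; simp_all)
      exact ⟨_, _, .h a c, c, h2.nameAt, h2.nameAt, by simp [hs, hi, value, this, hU],
        by simp [hi, value, this, hc], a, c, rfl, rfl⟩
    case consEntry =>
      obtain ⟨⟨t, b, b', h1, h2, h2'⟩, h0, h01⟩ := ih
      obtain ⟨U, v, W, he, rfl, rfl, hW⟩ := exists_cons h1 h2 h2'
      have : l U = x v :: l W := hsol _ he
      refine ⟨_, h2.nameAt, ?_⟩
      rw [decode_encodeNat, h01, h0]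
      refine ⟨le_rfl, by simp [this], fun i hi => ⟨U, v, W, he, ?_⟩⟩
      simp only [this, List.length_cons]
      lia
    case consEq =>
      obtain ⟨⟨t, b, b', h1, h2, h2'⟩, h0, h01⟩ := ih
      obtain ⟨U, v, W, he, rfl, rfl, hW⟩ := exists_cons h1 h2 h2'
      have : l U = x v :: l W := hsol _ he
      exact ⟨_, _, h2.nameAt, h2'.nameAt, by simp [h01, h0, value, this]⟩
    case consTailEntry =>
      obtain ⟨⟨t, b, b', h1, h2, h2'⟩, ⟨b'', h3, h4⟩, hs⟩ := ih
      obtain ⟨U, v, W, he, rfl, rfl, hW⟩ := exists_cons h1 h2 h2'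
      cases h3.unique hW
      rw [decode_encodeNat] at h4
      have : l U = x v :: l W := hsol _ he
      refine ⟨_, h2.nameAt, ?_⟩
      rw [decode_encodeNat, hs]
      refine ⟨by lia, by simpa [this] using h4.2.1, fun i hi => ?_⟩
      cases i with
      | zero => exact ⟨U, v, W, he, by simp [this]⟩
      | succ i =>
        obtain ⟨U', v', W', he', h5⟩ := h4.2.2 i (by lia)
        exact ⟨U', v', W', he', by simp only [this, List.length_cons]; lia⟩
    case consTailEntry' =>
      obtain ⟨⟨t, b, b', h1, h2, h2'⟩, ⟨b'', h3, h4⟩, hs, hs'⟩ := ih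
      obtain ⟨U, v, W, he, rfl, rfl, hW⟩ := exists_cons h1 h2 h2'
      cases h3.unique h2.nameAt
      rw [decode_encodeNat] at h4
      have : l U = x v :: l W := hsol _ he
      have hlen : (l U).length = (l W).length + 1 := by simp [this]
      refine ⟨_, hW, ?_⟩
      rw [decode_encodeNat]
      refine ⟨by lia, by have := h4.2.1; lia, fun i hi => ?_⟩
      obtain ⟨U', v', W', he', h5⟩ := h4.2.2 (i + 1) (by lia)
      exact ⟨U', v', W', he', by lia⟩
    case consTailEq =>
      obtain ⟨⟨t, b, b', h1, h2, h2'⟩, ⟨b'', h3, h4⟩, hs⟩ := ih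
      obtain ⟨U, v, W, he, rfl, rfl, hW⟩ := exists_cons h1 h2 h2'
      cases h3.unique hW
      have : l U = x v :: l W := hsol _ he
      obtain ⟨i, hi⟩ := Nat.exists_eq_succ_of_ne_zero (Nat.one_le_iff_ne_zero.1 h4.1)
      exact ⟨_, _, h2.nameAt, hW, by simp [hs, hi, value, this]⟩
    case entryDown =>
      obtain ⟨⟨b, h1, h2⟩, hs, hs'⟩ := ih
      exact ⟨b, h1, by lia, by have := h2.2.1; lia, fun i hi => h2.2.2 i (by lia)⟩
    case nilFail =>
      obtain ⟨⟨t, h1⟩, b, h3, h4⟩ := ih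
      obtain ⟨U, he, hU⟩ := exists_nil h1
      cases h3.unique hU
      rw [decode_encodeNat] at h4
      have : l U = [] := hsol _ he
      have := h4.1.trans h4.2.1
      simp_all
    case lastFail =>
      obtain ⟨⟨b, -, h⟩, hlast⟩ := ih
      have := h.lt
      lia
    case elemVar =>
      obtain ⟨⟨t, b, h1, h2⟩, h0⟩ := ih
      obtain ⟨u, v, he, rfl, hv⟩ := exists_elemVar h1 h2
      have : x u = x v := hsol _ he
      exact ⟨_, _, h2.nameAt, hv, by simp [h0, value, this]⟩
    case hLeft =>
      obtain ⟨⟨t, b, b', h1, h2, h2'⟩, h0⟩ := ih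
      obtain ⟨v, u, y, he, rfl, rfl, hy⟩ := exists_h h1 h2 h2'
      have : x v = .h (x u) (x y) := hsol _ he
      exact ⟨_, _, .h (x u) (x y), x u, h2.nameAt, h2'.nameAt, by simp [h0, value, this],
        by simp [h0, value], x u, x y, rfl, rfl⟩
    case hRight =>
      obtain ⟨⟨t, b, b', h1, h2, h2'⟩, h0⟩ := ih
      obtain ⟨v, u, y, he, rfl, rfl, hy⟩ := exists_h h1 h2 h2'
      have : x v = .h (x u) (x y) := hsol _ he
      exact ⟨_, _, .h (x u) (x y), x y, h2.nameAt, hy, by simp [h0, value, this],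
        by simp [h0, value], x u, x y, rfl, rfl⟩
    case const =>
      obtain ⟨⟨t, b, h1, h2⟩, h0⟩ := ih
      obtain ⟨u, c, he, rfl, hc⟩ := exists_const h1 h2
      have : x u = .const c := hsol _ he
      exact ⟨_, c, h2.nameAt, hc, by simp [h0, value, this]⟩
    case eqSymm =>
      obtain ⟨b, b', h1, h2, h3⟩ := ih
      exact ⟨b', b, h2, h1, h3.symm⟩
    case eqTrans =>
      obtain ⟨⟨b, b', h1, h2, h3⟩, b₁, b₁', h1', h2', h3'⟩ := ih
      cases h2.unique h1'
      exact ⟨b, b₁', h1, h2', h3.trans h3'⟩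
    case childRefl =>
      obtain ⟨b, -, -, -, h, -⟩ := ih
      exact ⟨b, b, h, h, rfl⟩
    case constRefl =>
      obtain ⟨b, -, h, -⟩ := ih
      exact ⟨b, b, h, h, rfl⟩
    case childEq =>
      obtain ⟨⟨b, b', t, t', h1, h2, h3, h4, h5⟩, ⟨b₁, b₁', t₁, t₁', h1', h2', h3', h4', h5'⟩,
        b₂, b₂', g1, g2, g3⟩ := ih
      cases g1.unique h1
      cases g2.unique h1'
      rw [h3, h3', Option.some.injEq] at g3
      subst g3
      exact ⟨b', b₁', h2, h2', by rw [h4, h4', h5.eq h5']⟩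
    case constConst =>
      obtain ⟨⟨b, c, h1, h2, h3⟩, ⟨b', c', h1', h2', h3'⟩, ⟨b₂, b₂', g1, g2, g3⟩, hd⟩ := ih
      cases g1.unique h1
      cases g2.unique h1'
      rw [h3, h3', Option.some.injEq, Term.const.injEq] at g3
      subst g3
      exact hd _ _ h2 h2' rfl
    case constChild =>
      obtain ⟨⟨b, c, h1, h2, h3⟩, ⟨b', b'', t, t', h1', h2', h3', h4', y, z, rfl, -⟩,
        ⟨b₂, b₂', g1, g2, g3⟩⟩ := ih
      cases g1.unique h1
      cases g2.unique h1'
      rw [h3, h3'] at g3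
      simp at g3
    case childSub =>
      obtain ⟨b, b', t, t', h1, h2, h3, h4, h5⟩ := ih
      exact ⟨b, b', t, t', h1, h2, h3, h4, h5.weight_lt⟩
    case eqSub =>
      obtain ⟨⟨b₂, b₂', g1, g2, g3⟩, b, b', t, t', h1, h2, h3, h4, h5⟩ := ih
      cases g2.unique h1
      exact ⟨b₂, b', t, t', g1, h2, g3.trans h3, h4, h5⟩
    case subTrans =>
      obtain ⟨⟨b, b', t, t', h1, h2, h3, h4, h5⟩, ⟨b₁, b₁', t₁, t₁', h1', h2', h3', h4', h5'⟩⟩ := ih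
      cases h2.unique h1'
      rw [h4, Option.some.injEq] at h3'
      subst h3'
      exact ⟨b, b₁', t, t₁', h1, h2', h3, h4', h5'.trans h5⟩
    case subFail =>
      obtain ⟨b, b', t, t', h1, h2, h3, h4, h5⟩ := ih
      cases h1.unique h2
      rw [h3, Option.some.injEq] at h4
      subst h4
      exact h5.false

end Soundness

end BC

namespace BC

open StackMachine Computability

variable {C : Type}

/-! ### Solutions of closed systems of equations -/

/-- Unification by congruence closure: if an equality relation on a set of nodes passes to the
arguments of terms `h`, if there are no clashes, and if the proper subterm relation is well-founded,
then terms can be assigned to the nodes. Equal nodes get equal terms. -/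
theorem exists_term_assignment {α : Type} [Nonempty α] {eq sub : α → α → Prop}
    {child : Bool → α → α → Prop} {const : α → C → Prop}
    (symm : ∀ {a b}, eq a b → eq b a) (trans : ∀ {a b c}, eq a b → eq b c → eq a c)
    (child_refl : ∀ {d a b}, child d a b → eq a a) (const_refl : ∀ {a c}, const a c → eq a a)
    (child_eq : ∀ {d a b a' b'}, child d a b → child d a' b' → eq a a' → eq b b')
    (const_const : ∀ {a c a' c'}, const a c → const a' c' → eq a a' → c = c')
    (const_child : ∀ {a c d a' b}, const a c → child d a' b → ¬ eq a a')
    (child_sub : ∀ {d a a' b}, eq a a' → child d a' b → sub a b)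
    (wf : WellFounded fun b a => sub a b) :
    ∃ T : α → Term C .elem, (∀ a b, eq a b → T a = T b) ∧
      (∀ a b c, child false a b → child true a c → T a = .h (T b) (T c)) ∧
      ∀ a c, const a c → T a = .const c := by
  classical
  -- the arguments and the constants of the whole class of a node
  let H (d : Bool) (a b : α) : Prop := ∃ a', eq a a' ∧ child d a' b
  let K (a : α) (c : C) : Prop := ∃ a', eq a a' ∧ const a' c
  have hsub : ∀ {d a}, (∃ b, H d a b) → sub a (Classical.epsilon (H d a)) := fun h => by
    obtain ⟨a', h1, h2⟩ := Classical.epsilon_spec h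
    exact child_sub h1 h2
  let F (a : α) (ih : ∀ b, sub a b → Term C .elem) : Term C .elem :=
    if h : (∃ b, H false a b) ∧ ∃ b, H true a b then
      .h (ih (Classical.epsilon (H false a)) (hsub h.1))
        (ih (Classical.epsilon (H true a)) (hsub h.2))
    else if h : ∃ c, K a c then .const h.choose else .var 0
  let T := wf.fix F
  have hT : ∀ a, T a = if (∃ b, H false a b) ∧ ∃ b, H true a b then
      .h (T (Classical.epsilon (H false a))) (T (Classical.epsilon (H true a)))
      else if h : ∃ c, K a c then .const h.choose else .var 0 := fun a => by
    rw [show T a = F a fun b _ => T b from wf.fix_eq F a]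
    simp only [F]
    split_ifs <;> rfl
  have hTeq : ∀ {a b}, eq a b → T a = T b := fun {a b} hab => by
    have hH : ∀ d, H d a = H d b := fun d => by
      ext c
      exact ⟨fun ⟨a', h1, h2⟩ => ⟨a', trans (symm hab) h1, h2⟩,
        fun ⟨a', h1, h2⟩ => ⟨a', trans hab h1, h2⟩⟩
    have hK : K a = K b := by
      ext c
      exact ⟨fun ⟨a', h1, h2⟩ => ⟨a', trans (symm hab) h1, h2⟩,
        fun ⟨a', h1, h2⟩ => ⟨a', trans hab h1, h2⟩⟩
    rw [hT a, hT b, hH, hH]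
    simp only [hK]
  have hchild : ∀ {d a b}, child d a b → T (Classical.epsilon (H d a)) = T b := fun {d a b} h => by
    obtain ⟨a', h1, h2⟩ := Classical.epsilon_spec (p := H d a) ⟨b, a, child_refl h, h⟩
    exact hTeq (child_eq h2 h (symm h1))
  refine ⟨T, fun a b => hTeq, fun a b c hb hc => ?_, fun a c hc => ?_⟩
  · rw [hT, if_pos ⟨⟨b, a, child_refl hb, hb⟩, c, a, child_refl hc, hc⟩, hchild hb, hchild hc]
  · have hex : ∃ c, K a c := ⟨c, a, const_refl hc, hc⟩
    rw [hT, if_neg, dif_pos hex]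
    · obtain ⟨a', h1, h2⟩ := hex.choose_spec
      rw [const_const h2 hc (symm h1)]
    · rintro ⟨⟨b, a', h1, h2⟩, -⟩
      exact const_child hc h2 h1

/-! ### Completeness of the rules -/

section Completeness

variable {w : List Letter}

theorem Derivable.le {f : Fact Rel} (h : Derivable w f) : ∀ i ∈ f.2, i ≤ w.length := by
  induction h with
  | base hf =>
    obtain rfl | rfl | ⟨a, p, q, h, rfl⟩ := mem_wordFacts_iff.1 hf
    · simp
    · simp
    · have := h.lt_length
      have := h.1
      simp
      lia
  | step k ρ hρ _ _ =>
    simp only [inst, List.mem_map, forall_exists_index, and_imp, forall_apply_eq_imp_iff₂]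
    exact fun i _ => hρ i

theorem rule_head_subset (k : RuleName) : ∀ i ∈ (rule k).head.2, ∃ a ∈ (rule k).body, i ∈ a.2 := by
  cases k <;> simp [rule]

/-- Application of a rule. The values of the variables need not be bounded separately, since all
variables of the head occur in the body. -/
theorem derivable_of_body (k : RuleName) (ρ : Fin 8 → ℕ)
    (h : (rule k).body.Forall fun a => Derivable w (inst ρ a)) :
    Derivable w (inst ρ (rule k).head) := by
  rw [List.forall_iff_forall_mem] at h
  have hle : ∀ a ∈ (rule k).body, ∀ i ∈ a.2, ρ i ≤ w.length := fun a ha i hi =>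
    (h a ha).le _ (List.mem_map_of_mem hi)
  set ρ' : Fin 8 → ℕ := fun i => min (ρ i) w.length with hρ'
  have heq : ∀ a : Rel × List (Fin 8), (∀ i ∈ a.2, ρ i ≤ w.length) → inst ρ' a = inst ρ a :=
    fun a ha => Prod.ext rfl (List.map_congr_left fun i hi => min_eq_left (ha i hi))
  rw [← heq _ fun i hi => ?_]
  · exact Derives.step k ρ' (fun i => min_le_right _ _) fun a ha => heq a (hle a ha) ▸ h a ha
  · obtain ⟨a, ha, hia⟩ := rule_head_subset k i hi
    exact hle a ha i hia

theorem Edge.derivable {a : Letter} {p q : ℕ} (h : Edge w a p q) : Derivable w (.edge a, [p, q]) :=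
  .base (mem_wordFacts_iff.2 (.inr (.inr ⟨a, p, q, h, rfl⟩)))

theorem derivable_zero : Derivable w (.zero, [0]) :=
  .base (mem_wordFacts_iff.2 (.inr (.inl rfl)))

theorem derivable_last : Derivable w (.last, [w.length]) :=
  .base (mem_wordFacts_iff.2 (.inl rfl))

theorem derivable_succ {p : ℕ} (h : p < w.length) : Derivable w (.succ, [p, p + 1]) :=
  derivable_of_body (.succ w[p]) ![p, p + 1, 0, 0, 0, 0, 0, 0]
    (edge_iff.2 ⟨List.getElem?_eq_getElem h, rfl⟩).derivable

theorem exists_name {p : ℕ} {b : List Bool} {s : List Letter}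
    (h : w.drop p = b.map Letter.bit ++ Letter.mark :: s) :
    ∃ q, Derivable w (.name, [p, q]) ∧ w.drop q = s := by
  induction b generalizing p with
  | nil =>
    obtain ⟨h1, h2⟩ := edge_of_drop h
    exact ⟨_, derivable_of_body .nameEnd ![p, p + 1, 0, 0, 0, 0, 0, 0] h1.derivable, h2⟩
  | cons x b ih =>
    obtain ⟨h1, h2⟩ := edge_of_drop h
    obtain ⟨q, h3, h4⟩ := ih h2
    exact ⟨q, derivable_of_body (.nameBit x) ![p, p + 1, q, 0, 0, 0, 0, 0] ⟨h1.derivable, h3⟩, h4⟩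

theorem derivable_same {p q : ℕ} {b : List Bool} (hp : NameAt w b p) (hq : NameAt w b q) :
    Derivable w (.same, [p, q]) := by
  induction b generalizing p q with
  | nil =>
    obtain ⟨s, hp⟩ := hp
    obtain ⟨s', hq⟩ := hq
    exact derivable_of_body .sameEnd ![p, p + 1, q, q + 1, 0, 0, 0, 0]
      ⟨(edge_of_drop hp).1.derivable, (edge_of_drop hq).1.derivable⟩
  | cons x b ih =>
    obtain ⟨s, hs⟩ := id hp
    obtain ⟨s', hs'⟩ := id hq
    have h1 := (edge_of_drop hs).1
    have h2 := (edge_of_drop hs').1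
    exact derivable_of_body (.sameBit x) ![p, p + 1, q, q + 1, 0, 0, 0, 0]
      ⟨h1.derivable, h2.derivable, ih ((nameAt_cons h1).1 hp) ((nameAt_cons h2).1 hq)⟩

theorem derivable_diff {p q : ℕ} {b b' : List Bool} (hp : NameAt w b p) (hq : NameAt w b' q)
    (h : b ≠ b') : Derivable w (.diff, [p, q]) := by
  induction b generalizing p q b' with
  | nil =>
    obtain ⟨s, hp⟩ := hp
    obtain ⟨s', hq⟩ := hq
    cases b' with
    | nil => exact absurd rfl h
    | cons y b' =>
      exact derivable_of_body (.diffEnd' y) ![q, q + 1, p, p + 1, 0, 0, 0, 0]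
        ⟨(edge_of_drop hq).1.derivable, (edge_of_drop hp).1.derivable⟩
  | cons x b ih =>
    obtain ⟨s, hs⟩ := id hp
    obtain ⟨s', hs'⟩ := id hq
    have h1 := (edge_of_drop hs).1
    cases b' with
    | nil =>
      exact derivable_of_body (.diffEnd x) ![p, p + 1, q, q + 1, 0, 0, 0, 0]
        ⟨h1.derivable, (edge_of_drop hs').1.derivable⟩
    | cons y b' =>
      have h2 := (edge_of_drop hs').1
      by_cases hxy : y = x
      · subst hxy
        exact derivable_of_body (.diffTail y) ![p, p + 1, q, q + 1, 0, 0, 0, 0]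
          ⟨h1.derivable, h2.derivable, ih ((nameAt_cons h1).1 hp) ((nameAt_cons h2).1 hq)
            fun hb => h (by rw [hb])⟩
      · obtain rfl : y = !x := by cases x <;> cases y <;> simp_all
        exact derivable_of_body (.diffBit x) ![p, p + 1, q, q + 1, 0, 0, 0, 0]
          ⟨h1.derivable, h2.derivable⟩

/-- The number `k`, which is the index of a variable or the code of a constant, is written in binary
at the position `p`. -/
def IsName (w : List Letter) (k p : ℕ) : Prop :=
  NameAt w (encodeNat k) p

theorem exists_name_of_writeName {p k : ℕ} {s : List Letter} (h : w.drop p = writeName k ++ s) :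
    IsName w k p ∧ ∃ q, Derivable w (.name, [p, q]) ∧ w.drop q = s := by
  rw [writeName, List.append_assoc, List.singleton_append] at h
  exact ⟨⟨s, h⟩, exists_name h⟩

theorem exists_eqn₁ {t k : ℕ} {i : Fin 7} {s : List Letter}
    (h : w.drop t = .tag i :: (writeName k ++ s)) :
    ∃ p, Derivable w (.eqn i, [p]) ∧ IsName w k p := by
  obtain ⟨h1, h2⟩ := edge_of_drop h
  exact ⟨_, derivable_of_body (.eqn₁ i) ![t, t + 1, 0, 0, 0, 0, 0, 0] h1.derivable,
    (exists_name_of_writeName h2).1⟩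

theorem exists_eqn₂ {t k k' : ℕ} {i : Fin 7} {s : List Letter}
    (h : w.drop t = .tag i :: (writeName k ++ (writeName k' ++ s))) :
    ∃ p q, Derivable w (.eqn i, [p, q]) ∧ IsName w k p ∧ IsName w k' q := by
  obtain ⟨h1, h2⟩ := edge_of_drop h
  obtain ⟨h3, q, h4, h5⟩ := exists_name_of_writeName h2
  exact ⟨_, q, derivable_of_body (.eqn₂ i) ![t, t + 1, q, 0, 0, 0, 0, 0] ⟨h1.derivable, h4⟩, h3,
    (exists_name_of_writeName h5).1⟩

theorem exists_eqn₃ {t k k' k'' : ℕ} {i : Fin 7} {s : List Letter}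
    (h : w.drop t = .tag i :: (writeName k ++ (writeName k' ++ (writeName k'' ++ s)))) :
    ∃ p q r, Derivable w (.eqn i, [p, q, r]) ∧ IsName w k p ∧ IsName w k' q ∧ IsName w k'' r := by
  obtain ⟨h1, h2⟩ := edge_of_drop h
  obtain ⟨h3, q, h4, h5⟩ := exists_name_of_writeName h2
  obtain ⟨h6, r, h7, h8⟩ := exists_name_of_writeName h5
  exact ⟨_, q, r, derivable_of_body (.eqn₃ i) ![t, t + 1, q, r, 0, 0, 0, 0]
    ⟨h1.derivable, h4, h7⟩, h3, h6, (exists_name_of_writeName h8).1⟩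

theorem entry_lt {p i : ℕ} (hno : ¬ Derivable w (.fail, []))
    (h : Derivable w (.entry, [p, i])) : i < w.length := by
  refine lt_of_le_of_ne (h.le i (by simp)) ?_
  rintro rfl
  exact hno (derivable_of_body .lastFail ![p, w.length, 0, 0, 0, 0, 0, 0] ⟨h, derivable_last⟩)

theorem entry_down {p i : ℕ} (hno : ¬ Derivable w (.fail, []))
    (h : Derivable w (.entry, [p, i + 2])) :
    Derivable w (.entry, [p, i + 1]) := by
  have hlt := entry_lt hno h
  have h1 : Derivable w (.succ, [i, i + 1]) := derivable_succ (by lia)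
  have h2 : Derivable w (.succ, [i + 1, i + 2]) := derivable_succ (by lia)
  exact derivable_of_body .entryDown ![p, i, i + 1, i + 2, 0, 0, 0, 0] ⟨h, h2, h1⟩

theorem exists_length (hno : ¬ Derivable w (.fail, [])) (p : ℕ) :
    ∃ m, ∀ j, Derivable w (.entry, [p, j + 1]) ↔ j < m := by
  classical
  have hex : ∃ m, ¬ Derivable w (.entry, [p, m + 1]) :=
    ⟨w.length, fun h => by have := entry_lt hno h; lia⟩
  refine ⟨Nat.find hex, fun j => ⟨fun h => ?_, fun h => not_not.1 (Nat.find_min hex h)⟩⟩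
  by_contra! hj
  induction j, hj using Nat.le_induction with
  | base => exact Nat.find_spec hex h
  | succ j hj ih => exact ih (entry_down hno h)

theorem wellFounded_sub (hno : ¬ Derivable w (.fail, [])) :
    WellFounded fun b a : ℕ × ℕ => Derivable w (.sub, [a.1, a.2, b.1, b.2]) := by
  classical
  -- the number of nodes below a node decreases
  let below (a : ℕ × ℕ) : Finset (ℕ × ℕ) :=
    (Finset.range (w.length + 1) ×ˢ Finset.range (w.length + 1)).filter fun b =>
      Derivable w (.sub, [a.1, a.2, b.1, b.2])
  refine Subrelation.wf (r := InvImage (· < ·) fun a => (below a).card) (fun {b a} h => ?_)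
    (InvImage.wf _ wellFounded_lt)
  refine Finset.card_lt_card ((Finset.ssubset_iff_of_subset fun c hc => ?_).2 ⟨b, ?_, fun hb => ?_⟩)
  · rw [Finset.mem_filter] at hc ⊢
    exact ⟨hc.1, derivable_of_body .subTrans ![a.1, a.2, b.1, b.2, c.1, c.2, 0, 0] ⟨h, hc.2⟩⟩
  · have := h.le b.1 (by simp)
    have := h.le b.2 (by simp)
    simp only [below, Finset.mem_filter, Finset.mem_product, Finset.mem_range]
    exact ⟨⟨by lia, by lia⟩, h⟩
  · exact hno (derivable_of_body .subFail ![b.1, b.2, 0, 0, 0, 0, 0, 0] (Finset.mem_filter.1 hb).2)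

variable [Encodable C]

/-- The terms at the nodes of a problem for which no failure is derivable. -/
theorem exists_node_terms (hno : ¬ Derivable w (.fail, [])) :
    ∃ T : ℕ → ℕ → Term C .elem,
      (∀ p i q j, Derivable w (.eq, [p, i, q, j]) → T p i = T q j) ∧
      (∀ p i q j r k, Derivable w (.child false, [p, i, q, j]) →
        Derivable w (.child true, [p, i, r, k]) → T p i = .h (T q j) (T r k)) ∧
      ∀ p i q c, Derivable w (.const, [p, i, q]) → IsName w (Encodable.encode c) q →
        T p i = .const c := by
  obtain ⟨T, h1, h2, h3⟩ := exists_term_assignment (C := C)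
    (eq := fun a b : ℕ × ℕ => Derivable w (.eq, [a.1, a.2, b.1, b.2]))
    (sub := fun a b => Derivable w (.sub, [a.1, a.2, b.1, b.2]))
    (child := fun d a b => Derivable w (.child d, [a.1, a.2, b.1, b.2]))
    (const := fun a c => ∃ q, Derivable w (.const, [a.1, a.2, q]) ∧
      IsName w (Encodable.encode c) q)
    (fun {a b} h => derivable_of_body .eqSymm ![a.1, a.2, b.1, b.2, 0, 0, 0, 0] h)
    (fun {a b c} h h' => derivable_of_body .eqTrans ![a.1, a.2, b.1, b.2, c.1, c.2, 0, 0] ⟨h, h'⟩)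
    (fun {d a b} h => derivable_of_body (.childRefl d) ![a.1, a.2, b.1, b.2, 0, 0, 0, 0] h)
    (fun {a c} ⟨q, h, _⟩ => derivable_of_body .constRefl ![a.1, a.2, q, 0, 0, 0, 0, 0] h)
    (fun {d a b a' b'} h h' he => derivable_of_body (.childEq d)
      ![a.1, a.2, b.1, b.2, a'.1, a'.2, b'.1, b'.2] ⟨h, h', he⟩)
    (fun {a c a' c'} ⟨q, h, hq⟩ ⟨q', h', hq'⟩ he => by
      by_contra hc
      refine hno (derivable_of_body .constConst ![a.1, a.2, q, a'.1, a'.2, q', 0, 0]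
        ⟨h, h', he, derivable_diff hq hq' fun hb => hc ?_⟩)
      have := congrArg decodeNat hb
      rw [decode_encodeNat, decode_encodeNat] at this
      exact Encodable.encode_injective this)
    (fun {a c d a' b} ⟨q, h, _⟩ h' he => hno (derivable_of_body (.constChild d)
      ![a.1, a.2, q, a'.1, a'.2, b.1, b.2, 0] ⟨h, h', he⟩))
    (fun {d a a' b} he h => derivable_of_body .eqSub ![a.1, a.2, a'.1, a'.2, b.1, b.2, 0, 0]
      ⟨he, derivable_of_body (.childSub d) ![a'.1, a'.2, b.1, b.2, 0, 0, 0, 0] h⟩)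
    (wellFounded_sub hno)
  exact ⟨fun p i => T (p, i), fun p i q j => h1 (p, i) (q, j),
    fun p i q j r k => h2 (p, i) (q, j) (r, k), fun p i q c h h' => h3 (p, i) c ⟨q, h, h'⟩⟩

/-- If no failure is derivable, then the problem has a solution. The value of a list variable
consists of the entries whose existence is derivable, and of no others. -/
theorem exists_solution (P : Problem C) (hno : ¬ Derivable (writeProblem P) (.fail, [])) :
    ∃ (x : ℕ → Term C .elem) (l : ℕ → List (Term C .elem)), ∀ e ∈ P, e.Holds x l := by
  classical
  obtain ⟨T, heq, hchild, hconst⟩ := exists_node_terms (C := C) hno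
  choose len hlen using exists_length hno
  let pos (k : ℕ) : ℕ := Classical.epsilon (IsName (writeProblem P) k)
  have hpos : ∀ {k p}, IsName (writeProblem P) k p → Derivable (writeProblem P) (.same, [pos k, p])
      ∧ Derivable (writeProblem P) (.same, [p, pos k]) := fun h =>
    ⟨derivable_same (Classical.epsilon_spec ⟨_, h⟩) h,
      derivable_same h (Classical.epsilon_spec ⟨_, h⟩)⟩
  let x (k : ℕ) : Term C .elem := T (pos k) 0
  let l (k : ℕ) : List (Term C .elem) := (List.range (len (pos k))).map fun j => T (pos k) (j + 1)
  have hx : ∀ {k p}, IsName (writeProblem P) k p → x k = T p 0 := fun {k p} h =>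
    heq _ _ _ _ (derivable_of_body .sameEq ![pos k, p, 0, 0, 0, 0, 0, 0]
      ⟨(hpos h).1, derivable_zero⟩)
  have hl : ∀ {k p}, IsName (writeProblem P) k p → ∀ j, (l k)[j]? =
      if Derivable (writeProblem P) (.entry, [p, j + 1]) then some (T p (j + 1)) else none := by
    intro k p h j
    have hiff : Derivable (writeProblem P) (.entry, [p, j + 1]) ↔ j < len (pos k) := by
      rw [← hlen]
      exact ⟨fun h' => derivable_of_body .sameEntry ![p, pos k, j + 1, 0, 0, 0, 0, 0]
        ⟨(hpos h).2, h'⟩, fun h' => derivable_of_body .sameEntry ![pos k, p, j + 1, 0, 0, 0, 0, 0]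
        ⟨(hpos h).1, h'⟩⟩
    split_ifs with he
    · have : T p (j + 1) = T (pos k) (j + 1) := heq _ _ _ _
        (derivable_of_body .sameEntryEq ![p, pos k, j + 1, 0, 0, 0, 0, 0] ⟨(hpos h).2, he⟩)
      simp [l, hiff.1 he, this]
    · rw [hiff, not_lt] at he
      simp [l, he]
  refine ⟨x, l, fun e he => ?_⟩
  obtain ⟨t, s, hdrop⟩ := exists_drop_of_mem he
  -- the word is not empty
  have hpositive : 0 < (writeProblem P).length := by
    refine List.length_pos_iff.2 fun h => ?_
    rw [h] at hdrop
    cases e <;> simp [writeEq] at hdrop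
  have hsucc : Derivable (writeProblem P) (.succ, [0, 1]) := derivable_succ hpositive
  cases e with
  | listVar U V =>
    simp only [writeEq, List.cons_append, List.append_assoc] at hdrop
    obtain ⟨p, q, h, hU, hV⟩ := exists_eqn₂ hdrop
    refine List.ext_getElem? fun j => ?_
    rw [hl hU, hl hV]
    have hiff : Derivable (writeProblem P) (.entry, [p, j + 1]) ↔
        Derivable (writeProblem P) (.entry, [q, j + 1]) :=
      ⟨fun h' => derivable_of_body .listVarEntry ![p, q, j + 1, 0, 0, 0, 0, 0] ⟨h, h'⟩,
        fun h' => derivable_of_body .listVarEntry' ![p, q, j + 1, 0, 0, 0, 0, 0] ⟨h, h'⟩⟩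
    split_ifs with h1 h2 h2
    · exact congrArg some (heq _ _ _ _
        (derivable_of_body .listVarEq ![p, q, j + 1, 0, 0, 0, 0, 0] ⟨h, h1⟩))
    · exact absurd (hiff.1 h1) h2
    · exact absurd (hiff.2 h2) h1
    · rfl
  | bc U V y =>
    simp only [writeEq, List.cons_append, List.append_assoc] at hdrop
    obtain ⟨p, q, r, h, hU, hV, hy⟩ := exists_eqn₃ hdrop
    have hiff : ∀ j, Derivable (writeProblem P) (.entry, [p, j + 1]) ↔
        Derivable (writeProblem P) (.entry, [q, j + 1]) := fun j =>
      ⟨fun h' => derivable_of_body .bcEntry ![p, q, r, j + 1, 0, 0, 0, 0] ⟨h, h'⟩,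
        fun h' => derivable_of_body .bcEntry' ![p, q, r, j + 1, 0, 0, 0, 0] ⟨h, h'⟩⟩
    change l U = chain (l V) (x y)
    refine List.ext_getElem? fun j => ?_
    by_cases hj : Derivable (writeProblem P) (.entry, [p, j + 1])
    · rw [hl hU, if_pos hj]
      induction j with
      | zero =>
        rw [chain_getElem?_zero, hl hV, if_pos ((hiff 0).1 hj), hx hy]
        exact congrArg some (hchild _ _ _ _ _ _
          (derivable_of_body .bcHeadLeft ![p, q, r, 0, 1, 0, 0, 0] ⟨h, derivable_zero, hsucc, hj⟩)
          (derivable_of_body .bcHeadRight ![p, q, r, 0, 1, 0, 0, 0] ⟨h, derivable_zero, hsucc, hj⟩))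
      | succ j ih =>
        have hj' := entry_down hno hj
        have hs : Derivable (writeProblem P) (.succ, [j + 1, j + 2]) :=
          derivable_succ (entry_lt hno hj')
        have hV' := hl hV (j + 1)
        rw [if_pos ((hiff _).1 hj)] at hV'
        rw [chain_getElem?_succ hV' (ih hj').symm]
        exact congrArg some (hchild _ _ _ _ _ _
          (derivable_of_body .bcTailLeft ![p, q, r, j + 1, j + 2, 0, 0, 0] ⟨h, hj', hs, hj⟩)
          (derivable_of_body .bcTailRight ![p, q, r, j + 1, j + 2, 0, 0, 0] ⟨h, hj', hs, hj⟩))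
    · have hV' := hl hV j
      rw [if_neg (mt (hiff j).2 hj), List.getElem?_eq_none_iff] at hV'
      rw [hl hU, if_neg hj, eq_comm, List.getElem?_eq_none_iff, length_chain]
      exact hV'
  | cons U v W =>
    simp only [writeEq, List.cons_append, List.append_assoc] at hdrop
    obtain ⟨p, q, r, h, hU, hv, hW⟩ := exists_eqn₃ hdrop
    change l U = x v :: l W
    refine List.ext_getElem? fun j => ?_
    rw [hl hU]
    cases j with
    | zero =>
      have hp : Derivable (writeProblem P) (.entry, [p, 0 + 1]) :=
        derivable_of_body .consEntry ![p, q, r, 0, 1, 0, 0, 0] ⟨h, derivable_zero, hsucc⟩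
      rw [if_pos hp, List.getElem?_cons_zero, hx hv]
      exact congrArg some (heq _ _ _ _ (derivable_of_body .consEq ![p, q, r, 0, 1, 0, 0, 0]
        ⟨h, derivable_zero, hsucc⟩))
    | succ j =>
      rw [List.getElem?_cons_succ, hl hW]
      by_cases hj : Derivable (writeProblem P) (.entry, [r, j + 1])
      · have hs : Derivable (writeProblem P) (.succ, [j + 1, j + 2]) :=
          derivable_succ (entry_lt hno hj)
        have hp : Derivable (writeProblem P) (.entry, [p, j + 1 + 1]) :=
          derivable_of_body .consTailEntry ![p, q, r, j + 1, j + 2, 0, 0, 0] ⟨h, hj, hs⟩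
        rw [if_pos hj, if_pos hp]
        exact congrArg some (heq _ _ _ _
          (derivable_of_body .consTailEq ![p, q, r, j + 1, j + 2, 0, 0, 0] ⟨h, hj, hs⟩))
      · rw [if_neg hj, if_neg]
        intro hj'
        have hlt := entry_lt hno hj'
        have hs : Derivable (writeProblem P) (.succ, [j + 1, j + 2]) := derivable_succ (by lia)
        have hs' : Derivable (writeProblem P) (.succ, [j, j + 1]) := derivable_succ (by lia)
        exact hj (derivable_of_body .consTailEntry' ![p, q, r, j, j + 1, j + 2, 0, 0]
          ⟨h, hj', hs, hs'⟩)
  | nil U =>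
    simp only [writeEq, List.cons_append] at hdrop
    obtain ⟨p, h, hU⟩ := exists_eqn₁ hdrop
    change l U = []
    refine List.ext_getElem? fun j => ?_
    rw [hl hU, if_neg, List.getElem?_nil]
    exact fun hj => hno (derivable_of_body .nilFail ![p, j + 1, 0, 0, 0, 0, 0, 0] ⟨h, hj⟩)
  | elemVar u v =>
    simp only [writeEq, List.cons_append, List.append_assoc] at hdrop
    obtain ⟨p, q, h, hu, hv⟩ := exists_eqn₂ hdrop
    change x u = x v
    rw [hx hu, hx hv]
    exact heq _ _ _ _ (derivable_of_body .elemVar ![p, q, 0, 0, 0, 0, 0, 0] ⟨h, derivable_zero⟩)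
  | h v u y =>
    simp only [writeEq, List.cons_append, List.append_assoc] at hdrop
    obtain ⟨p, q, r, h, hv, hu, hy⟩ := exists_eqn₃ hdrop
    change x v = .h (x u) (x y)
    rw [hx hv, hx hu, hx hy]
    exact hchild _ _ _ _ _ _
      (derivable_of_body .hLeft ![p, q, r, 0, 0, 0, 0, 0] ⟨h, derivable_zero⟩)
      (derivable_of_body .hRight ![p, q, r, 0, 0, 0, 0, 0] ⟨h, derivable_zero⟩)
  | const u c =>
    simp only [writeEq, List.cons_append, List.append_assoc] at hdrop
    obtain ⟨p, q, h, hu, hc⟩ := exists_eqn₂ hdrop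
    change x u = .const c
    rw [hx hu]
    exact hconst _ _ _ _ (derivable_of_body .const ![p, q, 0, 0, 0, 0, 0, 0] ⟨h, derivable_zero⟩) hc

end Completeness

theorem unifiable_iff_not_derivable [Encodable C] (P : Problem C) :
    Unifiable P ↔ ¬ Derivable (writeProblem P) (.fail, []) := by
  rw [unifiable_iff]
  exact ⟨fun ⟨_, _, h⟩ hf => meaning_of_derivable h hf, exists_solution P⟩

end BC

theorem mainTheorem4 (C : Type) [Encodable C] :
    ∃ decideUnif : BC.Problem C → Bool,
      (∀ P : BC.Problem C, decideUnif P = true ↔ BC.Unifiable P) ∧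
      Nonempty (Turing.TM2ComputableInPolyTime
        (BC.writeProblem (C := C)) Computability.encodeBool decideUnif) := by
  classical
  exact ⟨fun P => decide (BC.Unifiable P), fun P => decide_eq_true_iff,
    StackMachine.polyTime_of_rules BC.rule BC.Rel.edge .zero .last .fail _ _ fun P =>
      decide_eq_true_iff.trans (BC.unifiable_iff_not_derivable P)⟩
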